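/- Let $(X,d)$ be a separable metric space, $\mu$ a Borel probability measure on $X$ whose support is connected, and $f\colon X\to X$ an invertible $\mu$-preserving transformation (a bijection, Borel measurable together with its inverse). Put $$W^{ss}(x)=\{y: d(f^n(x),f^n(y))\to 0 \text{ as } n\to+\infty\},\qquad W^{su}(x)=\{y: d(f^{-n}(x),f^{-n}(y))\to 0\text{ as } n\to+\infty\}.$$ A set $V\subset X$ is an *$(ss,su)$-product set* if for $x\in V$ and $k\in\{ss,su\}$ there are sets $W^k_{loc}(x)\subset W^k(x)$, and there is a measurable map $[\cdot,\cdot]\colon V\times V\to X$ with $[x,y]\in W^{ss}_{loc}(x)\cap W^{su}_{loc}(y)$. We say that $W^{ss}$ is *absolutely continuous* on $V$ (with respect to $\mu$) if for $x\in V$ and $k\in\{ss,su\}$ there are Borel measures $\mu^k_x$ concentrated on $W^k_{loc}(x)$ such that 1. for all $x,y\in V$ and $N\subset W^{su}_{loc}(x)$: if $\mu^{su}_x(N)=0$, then $\mu^{su}_y(\{p\in W^{su}_{loc}(y)\cap V : [p,x]\in N\})=0$ (the holonomy $p\mapsto[p,x]$ along $W^{ss}$ from $W^{su}_{loc}(y)$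 to $W^{su}_{loc}(x)$ pulls null sets back to null sets); 2. for every $\varphi\in L^1(\mu)$ and every $z\in V$, the following iterated integral is well defined and $$\int_V\varphi\,d\mu=\int_{W^{ss}_{loc}(z)\cap V}\int_{W^{su}_{loc}(x)}\varphi\,d\mu^{su}_x\,d\mu^{ss}_z(x).$$ Suppose that every point of the support of $\mu$ lies in an open $(ss,su)$-product set on which $W^{ss}$ is absolutely continuous. Then $f$ is totally ergodic, that is, $f^n$ is ergodic with respect to $\mu$ for every integer $n\ge 1$. Moreover $f$ is multiply mixing: for every $N\in\mathbb N$ and all $\varphi_1,\dots,\varphi_N\in L^\infty(\mu)$, $$\prod_{i=1}^N\varphi_i\circ f^{\,n_1+\cdots+n_i}\longrightarrow\prod_{i=1}^N\int\varphi_i\,d\mu\quad\text{weakly in }L^2(\mu)\text{ as } n_1,\dots,n_N\to\infty,$$ that is, for all $\psi\in L^2(\mu)$ and $\varepsilon>0$ there is $K$ such that $$\Bigl|\int\psi\prod_{i=1}^N\varphi_i\circ f^{\,n_1+\cdots+n_i}\,d\mu-\int\psi\,d\mu\,\prod_{i=1}^N\int\varphi_i\,d\mu\Bigr|<\varepsilon$$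 whenever $n_i\ge K$ for all $i$. -/

import Mathlib

open MeasureTheory Filter Topology

/-- The stable set of `x` under `g`: the points `y` with `d (g^n x) (g^n y) → 0` as `n → ∞`. -/
def stableSet {X : Type*} [MetricSpace X] (g : X → X) (x : X) : Set X :=
  {y | Tendsto (fun n : ℕ => dist (g^[n] x) (g^[n] y)) atTop (𝓝 0)}

/-- `W^{ss}` of an invertible map: the strong stable sets. -/
def Wss {X : Type*} [MetricSpace X] [MeasurableSpace X] (f : X ≃ᵐ X) (x : X) : Set X :=
  stableSet f x

/-- `W^{su}` of an invertible map: the strong unstable sets, i.e. the points `y` with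
`d (f^{-n} x) (f^{-n} y) → 0` as `n → +∞`. -/
def Wsu {X : Type*} [MetricSpace X] [MeasurableSpace X] (f : X ≃ᵐ X) (x : X) : Set X :=
  stableSet f.symm x

/-- A structure of `(i, j)`-product set on `V`, for two families of sets `Wi`, `Wj`: local sets
`W_loc^k(x) ⊆ W^k(x)` for `x ∈ V`, `k ∈ {i, j}`, and a measurable bracket `V × V → X` with
`[x, y] ∈ W_loc^i(x) ∩ W_loc^j(y)`. Values at points outside `V` are irrelevant. -/
structure ProductStructure {X : Type*} [MeasurableSpace X] (Wi Wj : X → Set X) (V : Set X) where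
  /-- the local sets `W_loc^i(x)` -/
  loci : X → Set X
  /-- the local sets `W_loc^j(x)` -/
  locj : X → Set X
  /-- the bracket `[x, y]` -/
  bracket : X → X → X
  loci_subset : ∀ x ∈ V, loci x ⊆ Wi x
  locj_subset : ∀ x ∈ V, locj x ⊆ Wj x
  measurable_bracket : Measurable (fun p : V × V => bracket p.1 p.2)
  bracket_mem : ∀ x ∈ V, ∀ y ∈ V, bracket x y ∈ loci x ∩ locj y

/-- Absolute continuity of `W^i` on an `(i, j)`-product set `V`: there are measures `μ_x^i` on
`W_loc^i(x)` and `μ_x^j` on `W_loc^j(x)` (Borel measures on `X` that do not charge the complement)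
such that
* holonomies along `W^i` preserve null sets: if `μ_x^j(N) = 0`, then the set `[N, y]` of those
  points of `W_loc^j(y)` which the holonomy `p ↦ [p, x]` carries into `N` is `μ_y^j`-null;
* `∫_V φ dμ = ∫_{W_loc^i(z)} ∫_{W_loc^j(x)} φ dμ_x^j dμ_z^i(x)` for `φ ∈ L¹(μ)` and `z ∈ V`, the
  iterated integral being well defined. The outer integral runs over `x ∈ V`, because `μ_x^j` is
  given for such `x` only. -/
def ProductStructure.IsAbsolutelyContinuous {X : Type*} [MeasurableSpace X]
    {Wi Wj : X → Set X} {V : Set X} (P : ProductStructure Wi Wj V) (μ : Measure X) : Prop :=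
  ∃ μi μj : X → Measure X,
    (∀ x ∈ V, μi x (P.loci x)ᶜ = 0) ∧
    (∀ x ∈ V, μj x (P.locj x)ᶜ = 0) ∧
    (∀ x ∈ V, ∀ y ∈ V, ∀ N : Set X, N ⊆ P.locj x → μj x N = 0 →
      μj y {p | p ∈ V ∧ p ∈ P.locj y ∧ P.bracket p x ∈ N} = 0) ∧
    (∀ z ∈ V, ∀ φ : X → ℝ, Integrable φ μ →
      (∀ᵐ x ∂(μi z).restrict V, Integrable φ (μj x)) ∧
      Integrable (fun x => ∫ p, φ p ∂(μj x)) ((μi z).restrict V) ∧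
      ∫ p in V, φ p ∂μ = ∫ x in V, (∫ p, φ p ∂(μj x)) ∂(μi z))

/-- `f` is totally ergodic: every power `f^n`, `n ≥ 1`, is ergodic. -/
def TotallyErgodic {X : Type*} [MeasurableSpace X] (f : X → X) (μ : Measure X) : Prop :=
  ∀ n : ℕ, 1 ≤ n → Ergodic (f^[n]) μ

/-- `f` is multiply mixing: for all `N` and `φ_1, …, φ_N ∈ L^∞`, the products
`∏ i, φ_i ∘ f^{n_1 + ⋯ + n_i}` converge weakly in `L²` to the constant `∏ i, ∫ φ_i dμ` as all
`n_i → ∞` (the filter `atTop` on `Fin N → ℕ` is generated by the sets `{n | ∀ i, K ≤ n i}`). -/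
def MultiplyMixing {X : Type*} [MeasurableSpace X] (f : X → X) (μ : Measure X) : Prop :=
  ∀ (N : ℕ) (φ : Fin N → X → ℝ), (∀ i, MemLp (φ i) ⊤ μ) →
    ∀ ψ : X → ℝ, MemLp ψ 2 μ →
      Tendsto
        (fun n : Fin N → ℕ =>
          ∫ x, (∏ i, φ i (f^[∑ j ∈ Finset.Iic i, n j] x)) * ψ x ∂μ)
        atTop (𝓝 (∫ x, (∏ i, ∫ y, φ i y ∂μ) * ψ x ∂μ))

/-! The argument is of Hopf type, with convergence in measure in place of pointwise ergodic
averages. It has two halves.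

Rigidity (`SaturatedAE.exists_ae_eq_const`): a bounded function `g` that is `W^{ss}`-saturated
modulo `μ` is constant almost everywhere. All `g ∘ f^{-n}` are saturated on a common set of full
measure. If `φ` is uniformly continuous and `L¹`-close to `g`, then `φ ∘ f^{-n}` is equally close to
`g ∘ f^{-n}` by invariance, and becomes constant along each `W^{su}`-leaf as `n → ∞`. Hence, along a
subsequence, `g ∘ f^{-n}` is asymptotically constant on almost all of one local `W^{su}`-leaf;
absolutely continuous holonomy carries this to almost every other leaf of the product set. So the
mean oscillation of `g ∘ f^{-n}` over the product set tends to zero. Connectedness of the support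
spreads this to `X × X`, where the oscillation does not depend on `n` by invariance; it is therefore
zero.

Mixing: for uniformly continuous `φ_i` the products `∏ φ_i ∘ f^{n_1 + ⋯ + n_i}` are asymptotically
equal at points of the same strong stable set, so their weak limits are saturated, hence constant.
Induction on the number of factors identifies the constant. Density gives bounded `φ_i`, and total
ergodicity follows from the case of one factor. -/

/-! ### Approximation in `L¹` by uniformly continuous functions -/

theorem exists_uniformContinuous_eLpNorm_sub_le {X : Type*} [MetricSpace X]
    [MeasurableSpace X] [BorelSpace X] {μ : Measure X} [IsFiniteMeasure μ]
    {ψ : X → ℝ} (hψ : Integrable ψ μ) {ε : ENNReal} (hε : ε ≠ 0) :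
    ∃ φ : X → ℝ, eLpNorm (ψ - φ) 1 μ ≤ ε ∧ UniformContinuous φ := by
  refine MemLp.induction_dense (by simp) UniformContinuous ?_ (fun f g hf hg => hf.add hg)
    (fun f hf => ?_) (memLp_one_iff_integrable.2 hψ) hε
  · intro c s hs _ ε hε
    obtain ⟨η, ηpos, hη⟩ := exists_Lp_half ℝ μ 1 hε
    have key : ∀ η : ENNReal, η ≠ 0 → ∃ θ : ENNReal, θ ≠ 0 ∧ ‖c‖ₑ * θ ≤ η := by
      intro η hη
      rcases eq_or_ne ‖c‖ₑ 0 with h0 | h0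
      · exact ⟨1, one_ne_zero, by simp [h0]⟩
      · rcases eq_or_ne η ⊤ with rfl | hη'
        · exact ⟨1, one_ne_zero, le_top⟩
        · exact ⟨η / ‖c‖ₑ, (ENNReal.div_pos hη enorm_ne_top).ne',
            (ENNReal.mul_div_cancel h0 enorm_ne_top).le⟩
    obtain ⟨θ, hθ, hcθ⟩ := key η ηpos.ne'
    -- Inner regularity gives a closed `F ⊆ s`, and the Lipschitz thickened indicators of `F`
    -- converge to its indicator. The error splits into the excess of the thickening over `F` and
    -- the missed part `s \ F`.
    obtain ⟨F, hFs, hF, hμF⟩ := hs.exists_isClosed_sdiff_lt (measure_ne_top μ s) hθ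
    have hδ : ∀ n : ℕ, (0 : ℝ) < 1 / ((n : ℝ) + 1) := fun n => Nat.one_div_pos_of_nat
    have hlim := tendsto_lintegral_thickenedIndicator_of_isClosed μ hF hδ
      tendsto_one_div_add_atTop_nhds_zero_nat
    have hlt : μ F < μ F + θ := ENNReal.lt_add_right (measure_ne_top μ F) hθ
    obtain ⟨n, hn⟩ := (hlim.eventually (gt_mem_nhds hlt)).exists
    set T : X → NNReal := fun x => thickenedIndicator (hδ n) F x
    have hTc : UniformContinuous (fun x => (T x : ℝ)) :=
      uniformContinuous_subtype_val.comp
        (lipschitzWith_thickenedIndicator (hδ n) F).uniformContinuous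
    have hTm : Measurable T := (thickenedIndicator (hδ n) F).continuous.measurable
    have hT1 : ∀ x ∈ F, T x = 1 := fun x hx => thickenedIndicator_one (hδ n) F hx
    have hFT : ∀ x, F.indicator (fun _ => (1 : ENNReal)) x ≤ T x := by
      intro x
      by_cases hx : x ∈ F
      · simp [hx, hT1 x hx]
      · simp [hx]
    have hTF : ∫⁻ x, (T x - F.indicator (fun _ => (1 : ENNReal)) x) ∂μ ≤ θ := by
      rw [lintegral_sub (measurable_const.indicator hF.measurableSet) _ (ae_of_all _ hFT),
        lintegral_indicator_const hF.measurableSet, one_mul]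
      · exact tsub_le_iff_left.2 hn.le
      · rw [lintegral_indicator_const hF.measurableSet, one_mul]
        exact measure_ne_top _ _
    refine ⟨fun x => (T x : ℝ) * c, ?_, hTc.mul_const' c⟩
    have e : (fun x => (T x : ℝ) * c) - s.indicator (fun _ => c)
        = (fun x => ((T x : ℝ) - F.indicator (fun _ => (1 : ℝ)) x) * c)
          + (fun x => -((s \ F).indicator (fun _ => c) x)) := by
      ext x
      by_cases hxF : x ∈ F
      · simp [hxF, hFs hxF, sub_mul]
      · by_cases hxs : x ∈ s <;> simp [hxF, hxs, sub_eq_add_neg]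
    rw [e]
    refine (hη _ _ ?_ ?_ ?_ ?_).le
    · exact (((hTm.coe_nnreal_real.sub
        (measurable_const.indicator hF.measurableSet)).mul_const c)).aestronglyMeasurable
    · exact ((measurable_const.indicator (hs.diff hF.measurableSet)).neg).aestronglyMeasurable
    · rw [eLpNorm_one_eq_lintegral_enorm]
      refine le_trans ?_ hcθ
      rw [mul_comm]
      refine le_trans ?_ (mul_le_mul_left hTF _)
      rw [← lintegral_mul_const' _ _ enorm_ne_top]
      refine lintegral_mono fun x => ?_
      rw [enorm_mul]
      refine mul_le_mul_left ?_ _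
      by_cases hxF : x ∈ F
      · simp [hxF, hT1 x hxF]
      · simp [hxF]
    · rw [eLpNorm_one_eq_lintegral_enorm]
      simp only [enorm_neg, enorm_indicator_eq_indicator_enorm]
      rw [lintegral_indicator_const (hs.diff hF.measurableSet)]
      exact (mul_le_mul_right hμF.le _).trans hcθ
  · exact hf.continuous.aestronglyMeasurable

/-- Clamping to `[-M, M]` is 1-Lipschitz and fixes the values of `ψ` almost everywhere, so it
preserves uniform continuity and does not increase the error. -/
theorem exists_uniformContinuous_abs_le_integral_sub_le {X : Type*} [MetricSpace X]
    [MeasurableSpace X] [BorelSpace X] {μ : Measure X} [IsFiniteMeasure μ]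
    {ψ : X → ℝ} (hψ : AEStronglyMeasurable ψ μ) {M : ℝ} (hM : 0 ≤ M) (hb : ∀ᵐ x ∂μ, |ψ x| ≤ M)
    {ε : ℝ} (hε : 0 < ε) :
    ∃ φ : X → ℝ, UniformContinuous φ ∧ (∀ x, |φ x| ≤ M) ∧ ∫ x, |ψ x - φ x| ∂μ ≤ ε := by
  have hi : Integrable ψ μ := Integrable.of_bound hψ M hb
  obtain ⟨φ, h1, h2⟩ := exists_uniformContinuous_eLpNorm_sub_le hi
    (ε := ENNReal.ofReal ε) (by simpa using hε)
  have hφm : AEStronglyMeasurable φ μ := h2.continuous.aestronglyMeasurable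
  have hclamp : LipschitzWith 1 (fun t : ℝ => max (-M) (min t M)) :=
    (LipschitzWith.id.min_const M).const_max (-M)
  refine ⟨fun x => max (-M) (min (φ x) M), hclamp.uniformContinuous.comp h2, fun x => ?_, ?_⟩
  · exact abs_le.2 ⟨le_max_left _ _, max_le (by linarith) (min_le_right _ _)⟩
  · rw [eLpNorm_one_eq_lintegral_enorm] at h1
    have hcm : AEStronglyMeasurable (fun x => max (-M) (min (φ x) M)) μ :=
      (hclamp.continuous.comp h2.continuous).aestronglyMeasurable
    rw [integral_eq_lintegral_of_nonneg_ae (ae_of_all _ fun x => abs_nonneg _)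
      (by simpa only [Real.norm_eq_abs, Pi.sub_apply] using (hψ.sub hcm).norm)]
    refine ENNReal.toReal_le_of_le_ofReal hε.le (le_trans (lintegral_mono_ae ?_) h1)
    filter_upwards [hb] with x hx
    rw [← Real.norm_eq_abs, ofReal_norm]
    have h3 := hclamp.dist_le_mul (ψ x) (φ x)
    have h4 : max (-M) (min (ψ x) M) = ψ x := by
      rw [min_eq_left (abs_le.1 hx).2, max_eq_right (abs_le.1 hx).1]
    rw [h4, NNReal.coe_one, one_mul, dist_eq_norm, dist_eq_norm] at h3
    exact enorm_le_iff_norm_le.2 h3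

/-! ### Saturated functions on a single product set -/

/-- A consequence of Fatou's lemma: if the functions `E k n` have small integrals for large `k`,
uniformly in `n`, then almost every point has, for some `k`, small values `E k n x` for infinitely
many `n`. -/
theorem ae_forall_exists_frequently_lt {Y : Type*} [MeasurableSpace Y] {ν : Measure Y}
    {E : ℕ → ℕ → Y → ℝ} (hi : ∀ k n, Integrable (E k n) ν) (h0 : ∀ k n x, 0 ≤ E k n x)
    (hE : ∀ k n, ∫ x, E k n x ∂ν ≤ 1 / ((k : ℝ) + 1)) :
    ∀ᵐ x ∂ν, ∀ ε : ℝ, 0 < ε → ∃ k, ∃ᶠ n in atTop, E k n x < ε := by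
  have hm : ∀ k n, AEMeasurable (fun x => ENNReal.ofReal (E k n x)) ν := fun k n =>
    (hi k n).aestronglyMeasurable.aemeasurable.ennreal_ofReal
  have hL : ∀ k, AEMeasurable (fun x => liminf (fun n => ENNReal.ofReal (E k n x)) atTop) ν := by
    intro k
    have := hm k
    fun_prop
  have hint : ∀ k : ℕ, ∫⁻ x, (⨅ k, liminf (fun n => ENNReal.ofReal (E k n x)) atTop) ∂ν
      ≤ ENNReal.ofReal (1 / ((k : ℝ) + 1)) := by
    intro k
    refine (lintegral_mono fun x => iInf_le _ k).trans
      ((lintegral_liminf_le' (hm k)).trans (liminf_le_of_frequently_le' (.of_forall fun n => ?_)))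
    rw [← ofReal_integral_eq_lintegral_ofReal (hi k n) (ae_of_all _ (h0 k n))]
    exact ENNReal.ofReal_le_ofReal (hE k n)
  have hz : ∫⁻ x, (⨅ k, liminf (fun n => ENNReal.ofReal (E k n x)) atTop) ∂ν = 0 := by
    have hlim := ENNReal.tendsto_ofReal (tendsto_one_div_add_atTop_nhds_zero_nat (𝕜 := ℝ))
    rw [ENNReal.ofReal_zero] at hlim
    exact le_antisymm (ge_of_tendsto' hlim hint) zero_le
  filter_upwards [(lintegral_eq_zero_iff' (AEMeasurable.iInf hL)).1 hz] with x hx ε hε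
  have hlt : (⨅ k, liminf (fun n => ENNReal.ofReal (E k n x)) atTop) < ENNReal.ofReal ε := by
    rw [hx]; simpa using hε
  obtain ⟨k, hk⟩ := iInf_lt_iff.1 hlt
  exact ⟨k, (frequently_lt_of_liminf_lt (by isBoundedDefault) hk).mono
    fun n hn => (ENNReal.ofReal_lt_ofReal_iff hε).1 hn⟩

/-- If infinitely many terms of a sequence of functions are `L¹`-close to constants, with arbitrary
precision, then a subsequence minus suitable constants converges to zero almost everywhere. -/
theorem exists_subseq_sub_const_tendsto_ae {Y : Type*} [MeasurableSpace Y] {ν : Measure Y}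
    [IsFiniteMeasure ν] {h : ℕ → Y → ℝ} (hi : ∀ n, Integrable (h n) ν)
    (hc : ∀ ε : ℝ, 0 < ε → ∃ᶠ n in atTop, ∃ c : ℝ, ∫ x, |h n x - c| ∂ν < ε) :
    ∃ ns : ℕ → ℕ, StrictMono ns ∧ ∃ c : ℕ → ℝ,
      ∀ᵐ x ∂ν, Tendsto (fun j => h (ns j) x - c j) atTop (𝓝 0) := by
  obtain ⟨ms, hms, hms'⟩ := extraction_forall_of_frequently
    (P := fun j n => ∃ c : ℝ, ∫ x, |h n x - c| ∂ν < 1 / ((j : ℝ) + 1))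
    (fun j => hc _ Nat.one_div_pos_of_nat)
  choose c hc' using hms'
  have hi' : ∀ j, Integrable (fun x => h (ms j) x - c j) ν := fun j =>
    (hi _).sub (integrable_const _)
  have hT : TendstoInMeasure ν (fun j x => h (ms j) x - c j) atTop (fun _ => (0 : ℝ)) := by
    refine tendstoInMeasure_of_tendsto_eLpNorm (p := 1) one_ne_zero
      (fun j => (hi' j).aestronglyMeasurable) aestronglyMeasurable_const ?_
    have hlim := ENNReal.tendsto_ofReal (tendsto_one_div_add_atTop_nhds_zero_nat (𝕜 := ℝ))
    rw [ENNReal.ofReal_zero] at hlim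
    refine tendsto_of_tendsto_of_tendsto_of_le_of_le tendsto_const_nhds hlim
      (fun _ => zero_le) fun j => ?_
    rw [eLpNorm_one_eq_lintegral_enorm]
    have : ∀ x, ‖((fun x => h (ms j) x - c j) - (fun _ => 0) : Y → ℝ) x‖ₑ
        = ENNReal.ofReal |h (ms j) x - c j| := fun x => by
      simp [← Real.norm_eq_abs, ofReal_norm]
    simp only [this]
    rw [← ofReal_integral_eq_lintegral_ofReal (hi' j).abs (ae_of_all _ fun x => abs_nonneg _)]
    exact ENNReal.ofReal_le_ofReal (hc' j).le
  obtain ⟨ns, hns, hae⟩ := hT.exists_seq_tendsto_ae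
  exact ⟨ms ∘ ns, hms.comp hns, c ∘ ns, hae⟩

/-- A set whose measures `κ y B` integrate to zero is `κ y`-null for almost every `y`. -/
theorem ae_measure_eq_zero_of_integral_eq {X Y : Type*} [MeasurableSpace X] [MeasurableSpace Y]
    {ν : Measure Y} {κ : Y → Measure X} {B : Set X} (hB : MeasurableSet B)
    (hfin : ∀ᵐ y ∂ν, IsFiniteMeasure (κ y))
    (hi : Integrable (fun y => ∫ p, B.indicator (fun _ => (1 : ℝ)) p ∂κ y) ν)
    (h0 : ∫ y, (∫ p, B.indicator (fun _ => (1 : ℝ)) p ∂κ y) ∂ν = 0) :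
    ∀ᵐ y ∂ν, κ y B = 0 := by
  have h1 := (integral_eq_zero_iff_of_nonneg (fun y => integral_nonneg fun p =>
    Set.indicator_nonneg (fun _ _ => zero_le_one) p) hi).1 h0
  filter_upwards [h1, hfin] with y hy hf
  rw [Pi.zero_apply, integral_indicator_const _ hB] at hy
  simpa [Measure.real, ENNReal.toReal_eq_zero_iff] using hy

/-- The local Hopf argument, to be applied with `h n = g ∘ f^{-n}` and `Φ k n = φ_k ∘ f^{-n}`. The
error bound in `hhΦ` is uniform in `n`, which is what Fatou's lemma needs in order to pass from `μ`
to a single leaf. -/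
theorem ProductStructure.IsAbsolutelyContinuous.exists_subseq_tendsto_ae {X : Type*}
    [MeasurableSpace X] {Wi Wj : X → Set X} {V : Set X} {P : ProductStructure Wi Wj V}
    {μ : Measure X} [IsFiniteMeasure μ] (hP : P.IsAbsolutelyContinuous μ) (hV : MeasurableSet V)
    {G : Set X} (hG : MeasurableSet G) (hμG : μ Gᶜ = 0) {h : ℕ → X → ℝ}
    (hm : ∀ n, Measurable (h n)) (hi : ∀ n, Integrable (h n) μ)
    (hs : ∀ n, ∀ x ∈ G, ∀ y ∈ G, y ∈ Wi x → h n x = h n y)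
    {Φ : ℕ → ℕ → X → ℝ} (hΦm : ∀ k n, Measurable (Φ k n)) {C : ℝ} (hΦC : ∀ k n x, |Φ k n x| ≤ C)
    (hΦ : ∀ k, ∀ x, ∀ y ∈ Wj x, Tendsto (fun n => Φ k n y - Φ k n x) atTop (𝓝 0))
    (hhΦ : ∀ k n, ∫ x, |h n x - Φ k n x| ∂μ ≤ 1 / ((k : ℝ) + 1)) :
    ∃ ns : ℕ → ℕ, StrictMono ns ∧ ∃ c : ℕ → ℝ,
      ∀ᵐ x ∂μ.restrict V, Tendsto (fun j => h (ns j) x - c j) atTop (𝓝 0) := by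
  obtain ⟨μi, μj, -, hμj, hhol, hdis⟩ := hP
  rcases eq_or_ne (μ V) 0 with hμV | hμV
  · exact ⟨id, strictMono_id, 0, by simp [Measure.restrict_eq_zero.2 hμV]⟩
  obtain ⟨z, hz⟩ : V.Nonempty := Set.nonempty_iff_ne_empty.2 fun h => hμV (by simp [h])
  set ν := (μi z).restrict V with hν
  have hfin : ∀ᵐ y ∂ν, IsFiniteMeasure (μj y) := by
    filter_upwards [(hdis z hz (fun _ => (1 : ℝ)) (integrable_const _)).1] with y hy
    exact (integrable_const_iff_isFiniteMeasure one_ne_zero).1 hy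
  have hnull : ∀ B, MeasurableSet B → μ (B ∩ V) = 0 → ∀ᵐ y ∂ν, μj y B = 0 := by
    intro B hB h0
    obtain ⟨-, h2, h3⟩ := hdis z hz (B.indicator fun _ => (1 : ℝ))
      ((integrable_const _).indicator hB)
    refine ae_measure_eq_zero_of_integral_eq hB hfin h2 ?_
    rw [← h3, integral_indicator_const _ hB, measureReal_restrict_apply hB]
    simp [Measure.real, h0]
  have hint : ∀ k n, Integrable (fun x => |h n x - Φ k n x|) μ := fun k n =>
    ((hi n).sub (Integrable.of_bound (hΦm k n).aestronglyMeasurable C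
      (ae_of_all _ (hΦC k n)))).abs
  have hfat : ∀ᵐ x ∂ν, ∀ ε : ℝ, 0 < ε →
      ∃ k, ∃ᶠ n in atTop, ∫ p, |h n p - Φ k n p| ∂μj x < ε := by
    refine ae_forall_exists_frequently_lt (fun k n => (hdis z hz _ (hint k n)).2.1)
      (fun k n x => integral_nonneg fun p => abs_nonneg _) fun k n => ?_
    rw [← (hdis z hz _ (hint k n)).2.2]
    exact (setIntegral_le_integral (hint k n) (ae_of_all _ fun p => abs_nonneg _)).trans (hhΦ k n)
  have hGV : ∀ᵐ y ∂ν, μj y (V ∩ G)ᶜ = 0 := by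
    refine hnull _ (hV.inter hG).compl (measure_mono_null ?_ hμG)
    rintro p ⟨hp, hpV⟩ hpG
    exact hp ⟨hpV, hpG⟩
  have hV' : ∀ᵐ y ∂ν, y ∈ V := ae_restrict_mem hV
  have hhi : ∀ᵐ y ∂ν, ∀ n, Integrable (h n) (μj y) := ae_all_iff.2 fun n => (hdis z hz _ (hi n)).1
  have hν0 : ν ≠ 0 := by
    intro h0
    have h3 := (hdis z hz (fun _ => (1 : ℝ)) (integrable_const _)).2.2
    rw [← hν, h0] at h3
    simp [Measure.real, ENNReal.toReal_eq_zero_iff, hμV] at h3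
  have : (ae ν).NeBot := ae_neBot.2 hν0
  -- A reference leaf on which all the almost sure properties hold at once.
  obtain ⟨x₀, hx₀fin, hx₀fat, hx₀G, hx₀V, hx₀i⟩ :=
    (hfin.and (hfat.and (hGV.and (hV'.and hhi)))).exists
  have hloc : ∀ᵐ p ∂μj x₀, p ∈ P.locj x₀ := hμj x₀ hx₀V
  obtain ⟨ns, hns, c, hc⟩ := exists_subseq_sub_const_tendsto_ae hx₀i (by
    intro ε hε
    obtain ⟨k, hk⟩ := hx₀fat (ε / 2) (half_pos hε)
    have hΦi : ∀ n, Integrable (Φ k n) (μj x₀) := fun n =>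
      Integrable.of_bound (hΦm k n).aestronglyMeasurable C (ae_of_all _ (hΦC k n))
    -- On the leaf of `x₀` the function `Φ k n` is nearly its value at `x₀`, which then serves as
    -- the constant approximating `h n`.
    have hosc : Tendsto (fun n => ∫ p, |Φ k n p - Φ k n x₀| ∂μj x₀) atTop (𝓝 (∫ _, 0 ∂μj x₀)) := by
      refine tendsto_integral_of_dominated_convergence (fun _ => C + C)
        (fun n => ((hΦi n).sub (integrable_const _)).abs.aestronglyMeasurable)
        (integrable_const _) (fun n => ae_of_all _ fun p => ?_) ?_
      · rw [Real.norm_eq_abs, abs_abs]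
        exact (abs_sub _ _).trans (add_le_add (hΦC k n p) (hΦC k n x₀))
      · filter_upwards [hloc] with p hp
        simpa using (hΦ k x₀ p (P.locj_subset x₀ hx₀V hp)).abs
    rw [integral_zero] at hosc
    refine (hk.and_eventually (hosc.eventually (gt_mem_nhds (half_pos hε)))).mono ?_
    rintro n ⟨h1, h2⟩
    refine ⟨Φ k n x₀, lt_of_le_of_lt (b := ∫ p, |h n p - Φ k n p| ∂μj x₀ +
      ∫ p, |Φ k n p - Φ k n x₀| ∂μj x₀) ?_ (by linarith)⟩
    have i1 : Integrable (fun p => |h n p - Φ k n p|) (μj x₀) := ((hx₀i n).sub (hΦi n)).abs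
    have i2 : Integrable (fun p => |Φ k n p - Φ k n x₀|) (μj x₀) :=
      ((hΦi n).sub (integrable_const _)).abs
    rw [← integral_add i1 i2]
    exact integral_mono ((hx₀i n).sub (integrable_const _)).abs (i1.add i2)
      fun p => abs_sub_le _ _ _)
  refine ⟨ns, hns, c, ?_⟩
  set S : Set X := {p | Tendsto (fun j => h (ns j) p - c j) atTop (𝓝 0)} with hS
  have hSm : MeasurableSet S :=
    measurableSet_tendsto _ fun j => (hm (ns j)).sub measurable_const
  -- Points outside `V ∩ G` count as bad too: a holonomy image avoiding `N` then lies in `G`, where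
  -- saturation can be used.
  set N : Set X := {p | p ∈ P.locj x₀ ∧ ¬ (p ∈ V ∩ G ∧ p ∈ S)} with hN
  have hN0 : μj x₀ N = 0 := by
    refine measure_mono_null (t := (V ∩ G)ᶜ ∪ Sᶜ) ?_ (measure_union_null hx₀G hc)
    rintro p ⟨-, hp⟩
    by_contra hcon
    simp only [Set.mem_union, Set.mem_compl_iff, not_or, not_not] at hcon
    exact hp hcon
  have hae : ∀ᵐ y ∂ν, μj y Sᶜ = 0 := by
    filter_upwards [hGV, hV'] with y hyG hyV
    have h1 := hhol x₀ hx₀V y hyV N (fun p hp => hp.1) hN0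
    refine measure_mono_null ?_
      (measure_union_null (measure_union_null hyG (hμj y hyV)) h1)
    intro p hpS
    by_contra hcon
    simp only [Set.mem_union, Set.mem_compl_iff, not_or, not_not] at hcon
    obtain ⟨⟨⟨hpV, hpG⟩, hpl⟩, hpN⟩ := hcon
    have hbr := P.bracket_mem p hpV x₀ hx₀V
    have hq : P.bracket p x₀ ∈ V ∩ G ∧ P.bracket p x₀ ∈ S := by
      by_contra hq
      exact hpN ⟨hpV, hpl, hbr.2, hq⟩
    refine hpS ?_
    -- A point and its holonomy image share a `Wi`-set and both lie in `G`, so convergence at the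
    -- image is convergence at `p`.
    have : ∀ j, h (ns j) p = h (ns j) (P.bracket p x₀) := fun j =>
      hs _ p hpG _ hq.1.2 (P.loci_subset p hpV hbr.1)
    simpa only [hS, Set.mem_ofPred_eq, this] using hq.2
  change μ.restrict V Sᶜ = 0
  obtain ⟨-, -, h3⟩ := hdis z hz (Sᶜ.indicator fun _ => (1 : ℝ))
    ((integrable_const _).indicator hSm.compl)
  rw [integral_eq_zero_of_ae (μ := (μi z).restrict V), integral_indicator_const _ hSm.compl] at h3
  · simpa [Measure.real, ENNReal.toReal_eq_zero_iff] using h3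
  · filter_upwards [hae] with y hy
    rw [integral_indicator_const _ hSm.compl]
    simp [Measure.real, hy]

/-! ### Mean oscillation and connectedness of the support -/

/-- The oscillation `∫_S ∫_T d(h p, h q)` of a function between two sets. -/
noncomputable def oscBetween {X : Type*} [MeasurableSpace X] (μ : Measure X) (h : X → ℝ)
    (S T : Set X) : ENNReal :=
  ∫⁻ p in S, ∫⁻ q in T, edist (h p) (h q) ∂μ ∂μ

section oscBetween

variable {X : Type*} [MeasurableSpace X] {μ : Measure X} {h : X → ℝ}

theorem measurable_edist_prod (hh : Measurable h) :
    Measurable fun z : X × X => edist (h z.1) (h z.2) :=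
  (hh.comp measurable_fst).edist (hh.comp measurable_snd)

theorem oscBetween_comm [SFinite μ] (hh : Measurable h) (S T : Set X) :
    oscBetween μ h S T = oscBetween μ h T S := by
  unfold oscBetween
  rw [lintegral_lintegral_swap (measurable_edist_prod hh).aemeasurable]
  simp only [edist_comm]

theorem oscBetween_mono {S S' T T' : Set X} (hS : S ⊆ S') (hT : T ⊆ T') :
    oscBetween μ h S T ≤ oscBetween μ h S' T' :=
  lintegral_mono' (Measure.restrict_mono hS le_rfl)
    fun _ => lintegral_mono' (Measure.restrict_mono hT le_rfl) le_rfl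

/-- The triangle inequality through a third point `r`, integrated over `r ∈ W`. It makes vanishing
oscillation transitive through any `W` of positive measure. -/
theorem measure_mul_oscBetween_le [SFinite μ] (hh : Measurable h) (S T W : Set X) :
    μ W * oscBetween μ h S T ≤ μ T * oscBetween μ h W S + μ S * oscBetween μ h W T := by
  have hm : Measurable fun r => ∫⁻ p in S, edist (h r) (h p) ∂μ :=
    (measurable_edist_prod hh).lintegral_prod_right'
  have hm' : ∀ r, Measurable fun p => edist (h p) (h r) := fun r => hh.edist measurable_const
  calc μ W * oscBetween μ h S T
      = ∫⁻ r in W, (∫⁻ p in S, ∫⁻ q in T, edist (h p) (h q) ∂μ ∂μ) ∂μ := by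
        rw [setLIntegral_const, mul_comm]; rfl
    _ ≤ ∫⁻ r in W, (∫⁻ p in S, ∫⁻ q in T, (edist (h r) (h p) + edist (h r) (h q)) ∂μ ∂μ) ∂μ :=
        lintegral_mono fun r => lintegral_mono fun p => lintegral_mono fun q => by
          simpa only [edist_comm (h p) (h r)] using edist_triangle (h p) (h r) (h q)
    _ = ∫⁻ r in W, (μ T * ∫⁻ p in S, edist (h r) (h p) ∂μ
          + μ S * ∫⁻ q in T, edist (h r) (h q) ∂μ) ∂μ := by
        refine lintegral_congr fun r => ?_
        have hr : Measurable fun p => edist (h r) (h p) := measurable_const.edist hh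
        simp_rw [lintegral_add_left measurable_const, setLIntegral_const]
        rw [lintegral_add_left (hr.mul_const _), lintegral_mul_const _ hr, setLIntegral_const,
          mul_comm, mul_comm (μ S)]
    _ = _ := by
        rw [lintegral_add_left (hm.const_mul _), lintegral_const_mul _ hm,
          lintegral_const_mul _ (measurable_edist_prod hh).lintegral_prod_right']
        rfl

theorem tendsto_oscBetween_of_tendsto [IsFiniteMeasure μ] {ι : Type*} {l : Filter ι}
    {h : ι → X → ℝ} (hh : ∀ i, Measurable (h i)) {S T W : Set X} (hW : μ W ≠ 0)
    (hS : Tendsto (fun i => oscBetween μ (h i) W S) l (𝓝 0))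
    (hT : Tendsto (fun i => oscBetween μ (h i) W T) l (𝓝 0)) :
    Tendsto (fun i => oscBetween μ (h i) S T) l (𝓝 0) := by
  have h1 : Tendsto (fun i => (μ T * oscBetween μ (h i) W S + μ S * oscBetween μ (h i) W T) / μ W)
      l (𝓝 ((μ T * 0 + μ S * 0) / μ W)) :=
    ENNReal.Tendsto.div_const ((ENNReal.Tendsto.const_mul hS (.inr (measure_ne_top _ _))).add
      (ENNReal.Tendsto.const_mul hT (.inr (measure_ne_top _ _)))) (.inr hW)
  simp only [mul_zero, add_zero, ENNReal.zero_div] at h1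
  refine tendsto_of_tendsto_of_tendsto_of_le_of_le tendsto_const_nhds h1 (fun _ => zero_le)
    fun i => ?_
  rw [ENNReal.le_div_iff_mul_le (.inl hW) (.inl (measure_ne_top _ _)), mul_comm]
  exact measure_mul_oscBetween_le (hh i) S T W

/-- Over the disjointed cover the integral is a series dominated by `C` times the measures of the
pieces, which are summable. -/
theorem tendsto_lintegral_of_countable_cover [IsFiniteMeasure μ] {a : ℕ → X → ENNReal}
    {C : ENNReal} (hC : C ≠ ⊤) (haC : ∀ n x, a n x ≤ C) {U : ℕ → Set X}
    (hU : ∀ i, MeasurableSet (U i)) (hμU : μ (⋃ i, U i)ᶜ = 0)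
    (hlim : ∀ i, Tendsto (fun n => ∫⁻ x in U i, a n x ∂μ) atTop (𝓝 0)) :
    Tendsto (fun n => ∫⁻ x, a n x ∂μ) atTop (𝓝 0) := by
  have hD : ∀ i, MeasurableSet (disjointed U i) := .disjointed hU
  have h1 : ∀ n, ∫⁻ x, a n x ∂μ = ∫⁻ i, (∫⁻ x in disjointed U i, a n x ∂μ) ∂Measure.count := by
    intro n
    rw [lintegral_count, ← lintegral_iUnion hD (disjoint_disjointed U), iUnion_disjointed,
      Measure.restrict_eq_self_of_ae_mem (s := ⋃ i, U i) hμU]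
  simp only [h1]
  rw [show (𝓝 (0 : ENNReal)) = 𝓝 (∫⁻ _ : ℕ, 0 ∂Measure.count) by simp]
  refine tendsto_lintegral_of_dominated_convergence (fun i => C * μ (disjointed U i))
    (fun _ => measurable_of_countable _) (fun n => ae_of_all _ fun i => ?_) ?_
    (ae_of_all _ fun i => ?_)
  · change _ ≤ C * μ (disjointed U i)
    rw [← setLIntegral_const]
    exact lintegral_mono fun x => haC n x
  · rw [lintegral_count, ENNReal.tsum_mul_left,
      ← measure_iUnion (disjoint_disjointed U) hD]
    exact ENNReal.mul_ne_top hC (measure_ne_top _ _)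
  · exact tendsto_of_tendsto_of_tendsto_of_le_of_le tendsto_const_nhds (hlim i)
      (fun _ => zero_le) fun n => lintegral_mono' (Measure.restrict_mono (disjointed_subset U i)
        le_rfl) le_rfl

theorem edist_le_of_abs_le {a b M : ℝ} (ha : |a| ≤ M) (hb : |b| ≤ M) :
    edist a b ≤ ENNReal.ofReal (M + M) := by
  rw [edist_dist, Real.dist_eq]
  exact ENNReal.ofReal_le_ofReal ((abs_sub _ _).trans (add_le_add ha hb))

/-- The constants `c n` cancel in differences of values, so they need not converge; dominated
convergence is applied in each variable. -/
theorem tendsto_oscBetween_self_of_tendsto_sub_const [IsFiniteMeasure μ] {h : ℕ → X → ℝ}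
    (hh : ∀ n, Measurable (h n)) {M : ℝ} (hM : ∀ n x, |h n x| ≤ M) {c : ℕ → ℝ} {V : Set X}
    (hc : ∀ᵐ x ∂μ.restrict V, Tendsto (fun n => h n x - c n) atTop (𝓝 0)) :
    Tendsto (fun n => oscBetween μ (h n) V V) atTop (𝓝 0) := by
  have hb : ∀ n p q, edist (h n p) (h n q) ≤ ENNReal.ofReal (M + M) := fun n p q =>
    edist_le_of_abs_le (hM n p) (hM n q)
  rw [show (𝓝 (0 : ENNReal)) = 𝓝 (∫⁻ _ in V, 0 ∂μ) by simp]
  refine tendsto_lintegral_of_dominated_convergence (fun _ => ENNReal.ofReal (M + M) * μ V)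
    (fun n => (measurable_edist_prod (hh n)).lintegral_prod_right') (fun n => ae_of_all _ fun p => ?_)
    ?_ ?_
  · rw [← setLIntegral_const]
    exact lintegral_mono fun q => hb n p q
  · rw [setLIntegral_const]
    exact ENNReal.mul_ne_top (ENNReal.mul_ne_top ENNReal.ofReal_ne_top (measure_ne_top _ _))
      (measure_ne_top _ _)
  · filter_upwards [hc] with p hp
    rw [show (𝓝 (0 : ENNReal)) = 𝓝 (∫⁻ _ in V, 0 ∂μ) by simp]
    refine tendsto_lintegral_of_dominated_convergence (fun _ => ENNReal.ofReal (M + M))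
      (fun n => measurable_const.edist (hh n)) (fun n => ae_of_all _ fun q => hb n p q) ?_ ?_
    · rw [setLIntegral_const]
      exact ENNReal.mul_ne_top ENNReal.ofReal_ne_top (measure_ne_top _ _)
    · filter_upwards [hc] with q hq
      have h1 := (hp.sub hq).abs
      simp only [sub_sub_sub_cancel_right, sub_zero, abs_zero] at h1
      have h2 := ENNReal.tendsto_ofReal h1
      simpa only [ENNReal.ofReal_zero, edist_dist, Real.dist_eq] using h2

/-- Vanishing oscillation between the neighbourhoods of two support points is a symmetric and
transitive relation that holds for nearby points, hence for all points of the connected support.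
Countably many neighbourhoods cover almost everything. -/
theorem tendsto_oscBetween_univ [TopologicalSpace X] [SecondCountableTopology X]
    [OpensMeasurableSpace X] [IsFiniteMeasure μ] (hconn : IsConnected μ.support) {h : ℕ → X → ℝ}
    (hh : ∀ n, Measurable (h n)) {M : ℝ} (hM : ∀ n x, |h n x| ≤ M)
    (hloc : ∀ x ∈ μ.support, ∃ V, IsOpen V ∧ x ∈ V ∧
      Tendsto (fun n => oscBetween μ (h n) V V) atTop (𝓝 0)) :
    Tendsto (fun n => oscBetween μ (h n) Set.univ Set.univ) atTop (𝓝 0) := by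
  choose! V hVo hxV hV using hloc
  have hpos : ∀ x ∈ μ.support, ∀ U, IsOpen U → x ∈ U → μ U ≠ 0 := fun x hx U hU hxU =>
    ((Measure.mem_support_iff_forall x).1 hx U (hU.mem_nhds hxU)).ne'
  have hmono : ∀ {S S' T T' : Set X}, S ⊆ S' → T ⊆ T' →
      Tendsto (fun n => oscBetween μ (h n) S' T') atTop (𝓝 0) →
      Tendsto (fun n => oscBetween μ (h n) S T) atTop (𝓝 0) := fun hS hT hlim =>
    tendsto_of_tendsto_of_tendsto_of_le_of_le tendsto_const_nhds hlim (fun _ => zero_le)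
      fun n => oscBetween_mono hS hT
  have hsymm : ∀ {S T : Set X}, Tendsto (fun n => oscBetween μ (h n) S T) atTop (𝓝 0) →
      Tendsto (fun n => oscBetween μ (h n) T S) atTop (𝓝 0) := fun hlim =>
    hlim.congr fun n => oscBetween_comm (hh n) _ _
  have hall : ∀ x ∈ μ.support, ∀ y ∈ μ.support,
      Tendsto (fun n => oscBetween μ (h n) (V x) (V y)) atTop (𝓝 0) := by
    intro x hx y hy
    refine hconn.isPreconnected.induction₂
      (fun x y => Tendsto (fun n => oscBetween μ (h n) (V x) (V y)) atTop (𝓝 0)) ?_ ?_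
      (fun _ _ _ _ => hsymm) hx hy
    · intro x hx
      filter_upwards [mem_nhdsWithin_of_mem_nhds ((hVo x hx).mem_nhds (hxV x hx)),
        self_mem_nhdsWithin] with y hyV hy
      -- The overlap `V x ∩ V y` is an open neighbourhood of a support point, so it has positive
      -- measure and links the two sets.
      exact tendsto_oscBetween_of_tendsto hh
        (hpos y hy _ ((hVo x hx).inter (hVo y hy)) ⟨hyV, hxV y hy⟩)
        (hmono Set.inter_subset_left subset_rfl (hV x hx))
        (hmono Set.inter_subset_right subset_rfl (hV y hy))
    · intro x y z hx hy hz hxy hyz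
      exact tendsto_oscBetween_of_tendsto hh (hpos y hy _ (hVo y hy) (hxV y hy)) (hsymm hxy) hyz
  obtain ⟨x₀, hx₀⟩ := hconn.nonempty
  obtain ⟨t, hts, htc, htU⟩ := TopologicalSpace.countable_cover_nhdsWithin
    (fun x hx => mem_nhdsWithin_of_mem_nhds ((hVo x hx).mem_nhds (hxV x hx)))
  have htne : t.Nonempty := by
    by_contra hne
    rw [Set.not_nonempty_iff_eq_empty] at hne
    simpa [hne] using htU hx₀
  obtain ⟨e, he⟩ := htc.exists_eq_range htne
  have hes : ∀ i, e i ∈ μ.support := fun i => hts (he ▸ Set.mem_range_self i)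
  have hμU : μ (⋃ i, V (e i))ᶜ = 0 := by
    refine measure_mono_null (Set.compl_subset_compl.2 ?_) μ.measure_compl_support
    rwa [he, Set.biUnion_range] at htU
  have hlim : Tendsto (fun n => oscBetween μ (h n) (V x₀) Set.univ) atTop (𝓝 0) := by
    have hrw : ∀ n T, oscBetween μ (h n) (V x₀) T
        = ∫⁻ q in T, (∫⁻ p in V x₀, edist (h n p) (h n q) ∂μ) ∂μ := fun n T =>
      lintegral_lintegral_swap (measurable_edist_prod (hh n)).aemeasurable
    simp only [hrw, Measure.restrict_univ]
    refine tendsto_lintegral_of_countable_cover (C := ENNReal.ofReal (M + M) * μ (V x₀))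
      (ENNReal.mul_ne_top ENNReal.ofReal_ne_top (measure_ne_top _ _)) (fun n q => ?_)
      (fun i => (hVo _ (hes i)).measurableSet) hμU fun i => ?_
    · rw [← setLIntegral_const]
      exact lintegral_mono fun p => edist_le_of_abs_le (hM n p) (hM n q)
    · simpa only [hrw] using hall x₀ hx₀ _ (hes i)
  exact tendsto_oscBetween_of_tendsto hh (hpos x₀ hx₀ _ (hVo x₀ hx₀) (hxV x₀ hx₀)) hlim hlim

theorem exists_ae_eq_const_of_oscBetween_univ_eq_zero [NeZero μ] [SFinite μ] (hh : Measurable h)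
    (h0 : oscBetween μ h Set.univ Set.univ = 0) : ∃ c : ℝ, ∀ᵐ x ∂μ, h x = c := by
  unfold oscBetween at h0
  simp only [Measure.restrict_univ] at h0
  rw [lintegral_eq_zero_iff (measurable_edist_prod hh).lintegral_prod_right'] at h0
  obtain ⟨p, hp⟩ := h0.exists
  refine ⟨h p, ?_⟩
  filter_upwards [(lintegral_eq_zero_iff
    (f := fun q => edist (h p) (h q)) (measurable_const.edist hh)).1 hp] with q hq
  exact (edist_eq_zero.1 hq).symm

theorem oscBetween_univ_comp {g : X → X} (hg : MeasurePreserving g μ μ) [SFinite μ]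
    (hh : Measurable h) :
    oscBetween μ (h ∘ g) Set.univ Set.univ = oscBetween μ h Set.univ Set.univ := by
  unfold oscBetween
  simp only [Measure.restrict_univ, Function.comp_apply]
  have : ∀ p, ∫⁻ q, edist (h p) (h (g q)) ∂μ = ∫⁻ q, edist (h p) (h q) ∂μ := fun p =>
    hg.lintegral_comp (measurable_const.edist hh)
  simp only [fun p => this (g p)]
  exact hg.lintegral_comp (measurable_edist_prod hh).lintegral_prod_right'

end oscBetween

/-! ### Bounded saturated functions are constant -/

/-- A function is `W^{ss}`-saturated modulo `μ` if, on a set of full measure, it takes the same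
value at points of the same strong stable set. -/
def SaturatedAE {X : Type*} [MetricSpace X] [MeasurableSpace X] (f : X ≃ᵐ X) (μ : Measure X)
    (g : X → ℝ) : Prop :=
  ∃ G : Set X, MeasurableSet G ∧ μ Gᶜ = 0 ∧ ∀ x ∈ G, ∀ y ∈ G, y ∈ Wss f x → g x = g y

theorem UniformContinuous.tendsto_sub_of_mem_stableSet {X : Type*} [MetricSpace X] {g : X → X} {φ : X → ℝ}
    (hφ : UniformContinuous φ) {x y : X} (hy : y ∈ stableSet g x) {ι : Type*} {l : Filter ι}
    {m : ι → ℕ} (hm : Tendsto m l atTop) :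
    Tendsto (fun i => φ (g^[m i] x) - φ (g^[m i] y)) l (𝓝 0) := by
  rw [Metric.tendsto_nhds]
  intro ε hε
  obtain ⟨δ, hδ, h⟩ := Metric.uniformContinuous_iff.1 hφ ε hε
  have hy' : Tendsto (fun n : ℕ => dist (g^[n] x) (g^[n] y)) atTop (𝓝 0) := hy
  filter_upwards [(hy'.comp hm).eventually (gt_mem_nhds hδ)] with i hi
  simpa [dist_eq_norm] using h hi

theorem MeasureTheory.MeasurePreserving.integral_comp_of_aestronglyMeasurable {X Y : Type*}
    [MeasurableSpace X] [MeasurableSpace Y] {μ : Measure X} {ν : Measure Y} {T : X → Y}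
    (hT : MeasurePreserving T μ ν) {g : Y → ℝ} (hg : AEStronglyMeasurable g ν) :
    ∫ x, g (T x) ∂μ = ∫ y, g y ∂ν := by
  rw [← hT.map_eq] at hg ⊢
  exact (integral_map hT.measurable.aemeasurable hg).symm

section

variable {X : Type*} [MetricSpace X] [MeasurableSpace X] {f : X ≃ᵐ X} {μ : Measure X}

theorem symm_iterate_mem_Wss {x y : X} (h : y ∈ Wss f x) (n : ℕ) :
    f.symm^[n] y ∈ Wss f (f.symm^[n] x) := by
  have hcancel : ∀ m (z : X), f^[m + n] (f.symm^[n] z) = f^[m] z := fun m z => by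
    rw [Function.iterate_add_apply,
      (Function.LeftInverse.iterate (f.apply_symm_apply : Function.LeftInverse f f.symm) n) z]
  refine (tendsto_add_atTop_iff_nat n).1 ?_
  simp only [hcancel]
  exact h

theorem SaturatedAE.exists_forall_symm_iterate {g : X → ℝ} (hf : MeasurePreserving f μ μ)
    (hg : SaturatedAE f μ g) : ∃ G : Set X, MeasurableSet G ∧ μ Gᶜ = 0 ∧
      ∀ n : ℕ, ∀ x ∈ G, ∀ y ∈ G, y ∈ Wss f x → g (f.symm^[n] x) = g (f.symm^[n] y) := by
  obtain ⟨G, hG, hμG, h⟩ := hg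
  have hfn : ∀ n : ℕ, MeasurePreserving f.symm^[n] μ μ := fun n => (hf.symm f).iterate n
  -- `W^{ss}` is invariant under `f⁻¹`, so it suffices that the whole backward orbit stays in `G`.
  refine ⟨⋂ n : ℕ, f.symm^[n] ⁻¹' G, .iInter fun n => (hfn n).measurable hG, ?_, ?_⟩
  · rw [Set.compl_iInter, measure_iUnion_null_iff]
    intro n
    rw [← Set.preimage_compl, (hfn n).measure_preimage hG.compl.nullMeasurableSet, hμG]
  · intro n x hx y hy hxy
    exact h _ (Set.mem_iInter.1 hx n) _ (Set.mem_iInter.1 hy n) (symm_iterate_mem_Wss hxy n)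

theorem SaturatedAE.tendsto_oscBetween [BorelSpace X] [IsFiniteMeasure μ]
    (hf : MeasurePreserving f μ μ) {g : X → ℝ} (hg : SaturatedAE f μ g) (hgm : Measurable g)
    {M : ℝ} (hM : 0 ≤ M) (hgM : ∀ x, |g x| ≤ M) {V : Set X} (hV : MeasurableSet V)
    {P : ProductStructure (Wss f) (Wsu f) V} (hP : P.IsAbsolutelyContinuous μ) :
    Tendsto (fun n => oscBetween μ (g ∘ f.symm^[n]) V V) atTop (𝓝 0) := by
  refine tendsto_of_subseq_tendsto fun ns hns => ?_
  obtain ⟨G, hG, hμG, hs⟩ := hg.exists_forall_symm_iterate hf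
  have hfn : ∀ n : ℕ, MeasurePreserving f.symm^[n] μ μ := fun n => (hf.symm f).iterate n
  choose φ hφu hφM hφ using fun k : ℕ =>
    exists_uniformContinuous_abs_le_integral_sub_le (μ := μ) hgm.aestronglyMeasurable hM
      (ae_of_all _ hgM) (ε := 1 / ((k : ℝ) + 1)) Nat.one_div_pos_of_nat
  have hm : ∀ n, Measurable fun x => g (f.symm^[ns n] x) := fun n =>
    hgm.comp (hfn _).measurable
  obtain ⟨ms, -, c, hc⟩ := hP.exists_subseq_tendsto_ae hV hG hμG
    (h := fun n x => g (f.symm^[ns n] x)) (Φ := fun k n x => φ k (f.symm^[ns n] x)) (C := M)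
    hm (fun n => Integrable.of_bound (hm n).aestronglyMeasurable M (ae_of_all _ fun x => hgM _))
    (fun n => hs _) (fun k n => (hφu k).continuous.measurable.comp (hfn _).measurable)
    (fun k n x => hφM k _)
    (fun k x y hy => by
      simpa using ((hφu k).tendsto_sub_of_mem_stableSet hy hns).neg)
    (fun k n => by
      refine le_trans (le_of_eq ?_) (hφ k)
      exact (hfn (ns n)).integral_comp_of_aestronglyMeasurable (g := fun x => |g x - φ k x|)
        (hgm.sub (hφu k).continuous.measurable).abs.aestronglyMeasurable)
  exact ⟨ms, tendsto_oscBetween_self_of_tendsto_sub_const (fun n => hm _) (fun n x => hgM _) hc⟩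

theorem SaturatedAE.exists_ae_eq_const [BorelSpace X] [TopologicalSpace.SeparableSpace X]
    [IsProbabilityMeasure μ] (hconn : IsConnected μ.support) (hf : MeasurePreserving f μ μ)
    (hcover : ∀ x ∈ μ.support, ∃ V : Set X, IsOpen V ∧ x ∈ V ∧
      ∃ P : ProductStructure (Wss f) (Wsu f) V, P.IsAbsolutelyContinuous μ)
    {g : X → ℝ} (hg : SaturatedAE f μ g) (hgm : Measurable g) {M : ℝ} (hM : 0 ≤ M)
    (hgM : ∀ x, |g x| ≤ M) : ∃ c : ℝ, ∀ᵐ x ∂μ, g x = c := by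
  have : SecondCountableTopology X := UniformSpace.secondCountable_of_separable X
  have hfn : ∀ n : ℕ, MeasurePreserving f.symm^[n] μ μ := fun n => (hf.symm f).iterate n
  have hlim := tendsto_oscBetween_univ hconn (h := fun n => g ∘ f.symm^[n])
    (fun n => hgm.comp (hfn n).measurable) (fun n x => hgM _) fun x hx => by
      obtain ⟨V, hVo, hxV, P, hP⟩ := hcover x hx
      exact ⟨V, hVo, hxV, hg.tendsto_oscBetween hf hgm hM hgM hVo.measurableSet hP⟩
  -- Invariance of `μ` makes the sequence of oscillations constant, so its limit zero is its value.
  simp only [fun n => oscBetween_univ_comp (hfn n) hgm] at hlim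
  exact exists_ae_eq_const_of_oscBetween_univ_eq_zero hgm
    (tendsto_nhds_unique tendsto_const_nhds hlim)

end

/-! ### Weak limits of asymptotically saturated sequences -/

/-- In a Hilbert space, one can choose a convergent sequence of elements in a decreasing sequence
of bounded nonempty convex sets. -/
theorem exists_tendsto_of_antitone_convex {E : Type*} [NormedAddCommGroup E]
    [InnerProductSpace ℝ E] [CompleteSpace E] {S : ℕ → Set E} (hS : Antitone S)
    (hc : ∀ m, Convex ℝ (S m)) (hne : ∀ m, (S m).Nonempty) {C : ℝ}
    (hC : ∀ m, ∀ v ∈ S m, ‖v‖ ≤ C) :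
    ∃ v : ℕ → E, (∀ m, v m ∈ S m) ∧ ∃ w, Tendsto v atTop (𝓝 w) := by
  set d : ℕ → ℝ := fun m => sInf ((fun v => ‖v‖ ^ 2) '' S m) with hd
  have hbdd : ∀ m, BddBelow ((fun v : E => ‖v‖ ^ 2) '' S m) := fun m =>
    ⟨0, by rintro _ ⟨v, -, rfl⟩; positivity⟩
  have hdle : ∀ m, ∀ v ∈ S m, d m ≤ ‖v‖ ^ 2 := fun m v hv => csInf_le (hbdd m) ⟨v, hv, rfl⟩
  have hdmono : Monotone d := fun m n hmn =>
    csInf_le_csInf (hbdd m) ((hne n).image _) (Set.image_mono (hS hmn))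
  have hdC : ∀ m, d m ≤ C ^ 2 := fun m => by
    obtain ⟨v, hv⟩ := hne m
    exact (hdle m v hv).trans (pow_le_pow_left₀ (norm_nonneg _) (hC m v hv) 2)
  have hdbdd : BddAbove (Set.range d) := ⟨C ^ 2, by rintro _ ⟨m, rfl⟩; exact hdC m⟩
  have hdlim := tendsto_atTop_ciSup hdmono hdbdd
  have hv : ∀ m : ℕ, ∃ v ∈ S m, ‖v‖ ^ 2 < d m + 1 / ((m : ℝ) + 1) := fun m => by
    obtain ⟨_, ⟨v, hv, rfl⟩, hlt⟩ := exists_lt_of_csInf_lt ((hne m).image fun v => ‖v‖ ^ 2)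
      (lt_add_of_pos_right (d m) (Nat.one_div_pos_of_nat (α := ℝ) (n := m)))
    exact ⟨v, hv, hlt⟩
  choose v hvS hvd using hv
  refine ⟨v, hvS, ?_⟩
  -- The parallelogram law bounds `‖v m - v n‖ ^ 2` by `2‖v m‖ ^ 2 + 2‖v n‖ ^ 2` minus four times
  -- the squared norm of the midpoint, which lies in `S N`; this gives the factors 4.
  set b : ℕ → ℝ := fun m => 4 * ((⨆ i, d i) - d m) + 4 * (1 / ((m : ℝ) + 1)) with hb
  have hb0 : Tendsto b atTop (𝓝 0) := by
    have h1 := ((tendsto_const_nhds (x := ⨆ i, d i)).sub hdlim).const_mul 4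
    have h2 := (tendsto_one_div_add_atTop_nhds_zero_nat (𝕜 := ℝ)).const_mul 4
    simpa [hb] using h1.add h2
  have hkey : ∀ N m n, N ≤ m → N ≤ n → ‖v m - v n‖ ^ 2 ≤ b N := by
    intro N m n hm hn
    have hone : ∀ {m}, N ≤ m → 1 / ((m : ℝ) + 1) ≤ 1 / ((N : ℝ) + 1) := fun hm =>
      Nat.one_div_le_one_div hm
    have hmid : (1 / 2 : ℝ) • v m + (1 / 2 : ℝ) • v n ∈ S N :=
      hc N (hS hm (hvS m)) (hS hn (hvS n)) (by norm_num) (by norm_num) (by norm_num)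
    have h1 := hdle N _ hmid
    rw [← smul_add, norm_smul, mul_pow] at h1
    have h2 := parallelogram_law_with_norm ℝ (v m) (v n)
    have h3 := hvd m
    have h4 := hvd n
    have h5 := le_ciSup hdbdd m
    have h6 := le_ciSup hdbdd n
    have h7 := hone hm
    have h8 := hone hn
    norm_num at h1
    simp only [hb]
    linarith
  refine cauchySeq_tendsto_of_complete (cauchySeq_of_le_tendsto_0 (fun N => √(b N)) ?_ ?_)
  · intro m n N hm hn
    rw [dist_eq_norm]
    exact Real.le_sqrt_of_sq_le (hkey N m n hm hn)
  · simpa using hb0.sqrt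

section

variable {X : Type*} [MetricSpace X] [MeasurableSpace X] {f : X ≃ᵐ X} {μ : Measure X}
  [IsProbabilityMeasure μ]

/-- If all integrals were at least `ε`, so would be those of convex combinations of the `u k`.
Combinations of later and later tails can be chosen convergent in `L²`, and almost everywhere along
a subsequence. The limit is saturated, hence a constant, whose integral against `ψ` is zero: a
contradiction. -/
theorem exists_integral_mul_lt_of_asymptotically_saturated
    (hconst : ∀ g : X → ℝ, SaturatedAE f μ g → Measurable g → ∀ M, 0 ≤ M → (∀ x, |g x| ≤ M) →
      ∃ c : ℝ, ∀ᵐ x ∂μ, g x = c)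
    {u : ℕ → X → ℝ} (hum : ∀ k, Measurable (u k)) {M : ℝ} (hM : 0 ≤ M) (huM : ∀ k x, |u k x| ≤ M)
    (hu : ∀ x, ∀ y ∈ Wss f x, Tendsto (fun k => u k x - u k y) atTop (𝓝 0))
    {ψ : X → ℝ} (hψ : Integrable ψ μ) (hψ0 : ∫ x, ψ x ∂μ = 0) {ε : ℝ} (hε : 0 < ε) :
    ∃ k, ∫ x, u k x * ψ x ∂μ < ε := by
  by_contra! hcon
  -- The hulls consist of functions rather than of `L²` classes, because saturation compares values
  -- at individual points.
  set T : ℕ → Set (X → ℝ) := fun m => convexHull ℝ (u '' Set.Ici m)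
  have hmul : ∀ g : X → ℝ, Measurable g → (∀ x, |g x| ≤ M) →
      Integrable (fun x => g x * ψ x) μ := fun g hg hgM =>
    hψ.bdd_mul hg.aestronglyMeasurable (ae_of_all _ hgM)
  have hTA : ∀ m, ∀ g ∈ T m, Measurable g ∧ (∀ x, |g x| ≤ M) ∧ ε ≤ ∫ x, g x * ψ x ∂μ := by
    intro m
    refine convexHull_min (t := {g | Measurable g ∧ (∀ x, |g x| ≤ M) ∧ ε ≤ ∫ x, g x * ψ x ∂μ})
      ?_ ?_
    · rintro _ ⟨k, -, rfl⟩
      exact ⟨hum k, huM k, hcon k⟩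
    · rintro g ⟨hg, hgM, hgε⟩ g' ⟨hg', hgM', hgε'⟩ a b ha hb hab
      refine ⟨(hg.const_smul a).add (hg'.const_smul b), fun x => ?_, ?_⟩
      · have h1 := convex_Icc (-M) M (abs_le.1 (hgM x)) (abs_le.1 (hgM' x)) ha hb hab
        exact abs_le.2 h1
      · have h1 : ∀ x, (a • g + b • g') x * ψ x = a * (g x * ψ x) + b * (g' x * ψ x) := fun x => by
          simp only [Pi.add_apply, Pi.smul_apply, smul_eq_mul]; ring
        simp only [h1]
        rw [integral_add ((hmul g hg hgM).const_mul a) ((hmul g' hg' hgM').const_mul b),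
          integral_const_mul, integral_const_mul]
        nlinarith
  have hTsub : ∀ m, ∀ x y δ, (∀ k ≥ m, |u k x - u k y| ≤ δ) → ∀ g ∈ T m, |g x - g y| ≤ δ := by
    intro m x y δ hδ
    refine convexHull_min (t := {g : X → ℝ | |g x - g y| ≤ δ}) ?_ ?_
    · rintro _ ⟨k, hk, rfl⟩
      exact hδ k hk
    · intro g hg g' hg' a b ha hb hab
      have h1 := convex_Icc (-δ) δ (abs_le.1 hg) (abs_le.1 hg') ha hb hab
      have h2 : (a • g + b • g') x - (a • g + b • g') y = a • (g x - g y) + b • (g' x - g' y) := by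
        simp only [Pi.add_apply, Pi.smul_apply, smul_eq_mul]; ring
      change |_| ≤ δ
      rw [h2]
      exact abs_le.2 h1
  set S : ℕ → Set (Lp ℝ 2 μ) := fun m => {v | ∃ g ∈ T m, g =ᵐ[μ] v}
  have hSanti : Antitone S := by
    rintro m n hmn v ⟨g, hg, hgv⟩
    exact ⟨g, convexHull_mono (Set.image_mono (Set.Ici_subset_Ici.2 hmn)) hg, hgv⟩
  have hSconv : ∀ m, Convex ℝ (S m) := by
    rintro m v ⟨g, hg, hgv⟩ v' ⟨g', hg', hgv'⟩ a b ha hb hab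
    refine ⟨a • g + b • g', convex_convexHull ℝ _ hg hg' ha hb hab, ?_⟩
    filter_upwards [hgv, hgv', Lp.coeFn_add (a • v) (b • v'), Lp.coeFn_smul a v,
      Lp.coeFn_smul b v'] with x h1 h2 h3 h4 h5
    rw [h3]
    simp only [Pi.add_apply, Pi.smul_apply, h4, h5, h1, h2]
  have hSne : ∀ m, (S m).Nonempty := by
    intro m
    have hmem : MemLp (u m) 2 μ :=
      MemLp.of_bound (hum m).aestronglyMeasurable M (ae_of_all _ (huM m))
    exact ⟨hmem.toLp _, u m, subset_convexHull ℝ _ ⟨m, Set.self_mem_Ici, rfl⟩, hmem.coeFn_toLp.symm⟩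
  have hSM : ∀ m, ∀ v ∈ S m, ‖v‖ ≤ M := by
    rintro m v ⟨g, hg, hgv⟩
    have h1 := Lp.norm_le_of_ae_bound (f := v) hM (by
      filter_upwards [hgv] with x hx
      rw [← hx]
      exact (hTA m g hg).2.1 x)
    simpa [measureUnivNNReal] using h1
  obtain ⟨v, hvS, w, hw⟩ := exists_tendsto_of_antitone_convex hSanti hSconv hSne hSM
  choose g hgT hgv using hvS
  obtain ⟨ms, hms, hae⟩ := (tendstoInMeasure_of_tendsto_Lp hw).exists_seq_tendsto_ae
  have hlim : ∀ᵐ x ∂μ, Tendsto (fun j => g (ms j) x) atTop (𝓝 (w x)) := by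
    filter_upwards [hae, ae_all_iff.2 hgv] with x hx hgx
    simpa only [hgx] using hx
  have hclim : ∀ x, Tendsto (fun j => g (ms j) x) atTop (𝓝 (w x)) →
      max (-M) (min (w x) M) = w x := fun x hx => by
    have h1 := abs_le.1 (le_of_tendsto' hx.abs fun j => (hTA _ _ (hgT (ms j))).2.1 x)
    rw [min_eq_left h1.2, max_eq_right h1.1]
  -- Clamping makes the representative bounded everywhere and changes nothing at points of
  -- convergence.
  have hsat : SaturatedAE f μ (fun x => max (-M) (min (w x) M)) := by
    refine ⟨(toMeasurable μ {x | ¬ Tendsto (fun j => g (ms j) x) atTop (𝓝 (w x))})ᶜ,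
      (measurableSet_toMeasurable _ _).compl, ?_, ?_⟩
    · rw [compl_compl, measure_toMeasurable]
      exact hlim
    · intro x hx y hy hxy
      have hx' : Tendsto (fun j => g (ms j) x) atTop (𝓝 (w x)) := by
        by_contra h
        exact hx (subset_toMeasurable _ _ h)
      have hy' : Tendsto (fun j => g (ms j) y) atTop (𝓝 (w y)) := by
        by_contra h
        exact hy (subset_toMeasurable _ _ h)
      have h0 : Tendsto (fun j => g (ms j) x - g (ms j) y) atTop (𝓝 0) := by
        rw [Metric.tendsto_atTop]
        intro δ hδ
        obtain ⟨K, hK⟩ := Metric.tendsto_atTop.1 (hu x y hxy) (δ / 2) (half_pos hδ)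
        refine ⟨K, fun j hj => ?_⟩
        rw [Real.dist_eq, sub_zero]
        refine lt_of_le_of_lt (hTsub (ms j) x y (δ / 2) (fun k hk => ?_) _ (hgT (ms j)))
          (half_lt_self hδ)
        have := hK k (hj.trans ((hms.id_le j).trans hk))
        rw [Real.dist_eq, sub_zero] at this
        exact this.le
      have h1 := tendsto_nhds_unique h0 (hx'.sub hy')
      change max (-M) (min (w x) M) = max (-M) (min (w y) M)
      rw [hclim x hx', hclim y hy']
      linarith
  obtain ⟨c, hc⟩ := hconst _ hsat
    (measurable_const.max ((Lp.stronglyMeasurable w).measurable.min measurable_const)) M hM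
    fun x => abs_le.2 ⟨le_max_left _ _, max_le (by linarith) (min_le_right _ _)⟩
  have hint : Tendsto (fun j => ∫ x, g (ms j) x * ψ x ∂μ) atTop (𝓝 (∫ x, c * ψ x ∂μ)) := by
    refine tendsto_integral_of_dominated_convergence (fun x => M * |ψ x|)
      (fun j => (hmul _ (hTA _ _ (hgT _)).1 (hTA _ _ (hgT _)).2.1).aestronglyMeasurable)
      (hψ.abs.const_mul M) (fun j => ae_of_all _ fun x => ?_) ?_
    · rw [Real.norm_eq_abs, abs_mul]
      exact mul_le_mul_of_nonneg_right ((hTA _ _ (hgT _)).2.1 x) (abs_nonneg _)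
    · filter_upwards [hlim, hc] with x hx hcx
      rw [← hcx, hclim x hx]
      exact hx.mul_const _
  rw [integral_const_mul, hψ0, mul_zero] at hint
  exact absurd (ge_of_tendsto' hint fun j => (hTA _ _ (hgT _)).2.2) (not_le.2 hε)

theorem tendsto_integral_mul_of_asymptotically_saturated
    (hconst : ∀ g : X → ℝ, SaturatedAE f μ g → Measurable g → ∀ M, 0 ≤ M → (∀ x, |g x| ≤ M) →
      ∃ c : ℝ, ∀ᵐ x ∂μ, g x = c)
    {u : ℕ → X → ℝ} (hum : ∀ k, Measurable (u k)) {M : ℝ} (hM : 0 ≤ M) (huM : ∀ k x, |u k x| ≤ M)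
    (hu : ∀ x, ∀ y ∈ Wss f x, Tendsto (fun k => u k x - u k y) atTop (𝓝 0))
    {ψ : X → ℝ} (hψ : Integrable ψ μ) (hψ0 : ∫ x, ψ x ∂μ = 0) :
    Tendsto (fun k => ∫ x, u k x * ψ x ∂μ) atTop (𝓝 0) := by
  have key : ∀ ψ : X → ℝ, Integrable ψ μ → ∫ x, ψ x ∂μ = 0 → ∀ ε > 0,
      ∀ᶠ k in atTop, ∫ x, u k x * ψ x ∂μ < ε := by
    intro ψ hψ hψ0 ε hε
    by_contra hcon
    obtain ⟨ms, hms, h⟩ := extraction_of_frequently_atTop (not_eventually.1 hcon)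
    obtain ⟨k, hk⟩ := exists_integral_mul_lt_of_asymptotically_saturated hconst
      (u := fun k => u (ms k)) (fun k => hum _) hM (fun k => huM _)
      (fun x y hy => (hu x y hy).comp hms.tendsto_atTop) hψ hψ0 hε
    exact h k hk
  rw [Metric.tendsto_nhds]
  intro ε hε
  filter_upwards [key ψ hψ hψ0 ε hε,
    key (fun x => -ψ x) hψ.neg (by rw [integral_neg, hψ0, neg_zero]) ε hε] with k h1 h2
  simp only [mul_neg, integral_neg] at h2
  rw [Real.dist_eq, sub_zero]
  exact abs_lt.2 ⟨by linarith, h1⟩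

end

/-! ### Multiple mixing: induction on the factors, then density -/

theorem abs_prod_sub_prod_le {ι : Type*} (s : Finset ι) {a b : ι → ℝ} {M : ℝ} (hM : 1 ≤ M)
    (ha : ∀ i ∈ s, |a i| ≤ M) (hb : ∀ i ∈ s, |b i| ≤ M) :
    |∏ i ∈ s, a i - ∏ i ∈ s, b i| ≤ M ^ s.card * ∑ i ∈ s, |a i - b i| := by
  classical
  induction s using Finset.induction_on with
  | empty => simp
  | insert i s hi ih =>
    rw [Finset.prod_insert hi, Finset.prod_insert hi, Finset.sum_insert hi,
      Finset.card_insert_of_notMem hi]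
    have ih' := ih (fun j hj => ha j (Finset.mem_insert_of_mem hj))
      (fun j hj => hb j (Finset.mem_insert_of_mem hj))
    have hM0 : 0 ≤ M := zero_le_one.trans hM
    have h1 : |∏ j ∈ s, b j| ≤ M ^ s.card := by
      rw [Finset.abs_prod, ← Finset.prod_const]
      exact Finset.prod_le_prod (fun _ _ => abs_nonneg _)
        fun j hj => hb j (Finset.mem_insert_of_mem hj)
    have h2 : M ^ s.card ≤ M ^ (s.card + 1) := pow_le_pow_right₀ hM (Nat.le_succ _)
    calc |a i * ∏ j ∈ s, a j - b i * ∏ j ∈ s, b j|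
        = |(a i - b i) * ∏ j ∈ s, b j + a i * (∏ j ∈ s, a j - ∏ j ∈ s, b j)| := by
          congr 1; ring
      _ ≤ |a i - b i| * |∏ j ∈ s, b j| + |a i| * |∏ j ∈ s, a j - ∏ j ∈ s, b j| := by
          rw [← abs_mul, ← abs_mul]; exact abs_add_le _ _
      _ ≤ |a i - b i| * M ^ (s.card + 1) + M * (M ^ s.card * ∑ j ∈ s, |a j - b j|) :=
          add_le_add (mul_le_mul_of_nonneg_left (h1.trans h2) (abs_nonneg _))
            (mul_le_mul (ha i (Finset.mem_insert_self i s)) ih' (abs_nonneg _) hM0)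
      _ = M ^ (s.card + 1) * (|a i - b i| + ∑ j ∈ s, |a j - b j|) := by ring

theorem sum_Iic_succ {N : ℕ} (n : Fin (N + 1) → ℕ) (i : Fin N) :
    ∑ j ∈ Finset.Iic i.succ, n j = (∑ j ∈ Finset.Iic i, n j.succ) + n 0 := by
  have h : ∀ {k : ℕ} (i : Fin k), Finset.Iic i = Finset.univ.filter (· ≤ i) := fun i => by
    ext; simp
  rw [h, h, Finset.sum_filter, Finset.sum_filter, Fin.sum_univ_succ, add_comm]
  simp

theorem abs_prod_univ_le {N : ℕ} {a : Fin N → ℝ} {M : ℝ} (ha : ∀ i, |a i| ≤ M) :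
    |∏ i, a i| ≤ M ^ N := by
  rw [Finset.abs_prod]
  exact (Finset.prod_le_prod (fun _ _ => abs_nonneg _) fun i _ => ha i).trans (by simp)

theorem tendsto_atTop_fin_iff {N : ℕ} {s : ℕ → Fin N → ℕ} :
    Tendsto s atTop atTop ↔ ∀ i, Tendsto (fun k => s k i) atTop atTop :=
  ⟨fun h i => tendsto_atTop.2 fun b => (tendsto_atTop.1 h fun _ => b).mono fun _ hk => hk i,
    fun h => tendsto_atTop.2 fun b => eventually_all.2 fun i => tendsto_atTop.1 (h i) (b i)⟩

/-- Limits may be computed up to arbitrarily small uniform errors. -/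
theorem tendsto_of_forall_approx {ι : Type*} {l : Filter ι} {F : ι → ℝ} {L : ℝ}
    (h : ∀ ε : ℝ, 0 < ε → ∃ (F' : ι → ℝ) (L' : ℝ), Tendsto F' l (𝓝 L') ∧
      (∀ i, |F i - F' i| ≤ ε) ∧ |L - L'| ≤ ε) : Tendsto F l (𝓝 L) := by
  rw [Metric.tendsto_nhds]
  intro ε hε
  obtain ⟨F', L', hlim, hF, hL⟩ := h (ε / 4) (by linarith)
  filter_upwards [Metric.tendsto_nhds.1 hlim (ε / 4) (by linarith)] with i hi
  have h1 := hF i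
  rw [Real.dist_eq] at hi ⊢
  rw [abs_le] at h1 hL
  rw [abs_lt] at hi ⊢
  constructor <;> linarith [h1.1, h1.2, hL.1, hL.2, hi.1, hi.2]

section

variable {X : Type*} [MetricSpace X] [MeasurableSpace X] [BorelSpace X] {f : X ≃ᵐ X}
  {μ : Measure X} [IsProbabilityMeasure μ]

/-- Splitting `ψ` into its mean and a function of zero mean leaves, by asymptotic saturation, only
the integrals of the products `u k`. The exponent `n 0` occurs in every factor, so invariance
removes it: the first function becomes the test function for the remaining `N` factors. -/
theorem tendsto_integral_prod_of_uniformContinuous (hf : MeasurePreserving f μ μ)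
    (hconst : ∀ g : X → ℝ, SaturatedAE f μ g → Measurable g → ∀ M, 0 ≤ M → (∀ x, |g x| ≤ M) →
      ∃ c : ℝ, ∀ᵐ x ∂μ, g x = c) {M : ℝ} (hM : 1 ≤ M) (N : ℕ) :
    ∀ φ : Fin N → X → ℝ, (∀ i, UniformContinuous (φ i)) → (∀ i x, |φ i x| ≤ M) →
      ∀ ψ : X → ℝ, Integrable ψ μ →
        Tendsto (fun n : Fin N → ℕ => ∫ x, (∏ i, φ i (f^[∑ j ∈ Finset.Iic i, n j] x)) * ψ x ∂μ)
          atTop (𝓝 (∫ x, (∏ i, ∫ y, φ i y ∂μ) * ψ x ∂μ)) := by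
  have hM0 : 0 ≤ M := zero_le_one.trans hM
  have hfn : ∀ n : ℕ, MeasurePreserving f^[n] μ μ := fun n => hf.iterate n
  induction N with
  | zero => intro φ _ _ ψ _; simp
  | succ N ih =>
    intro φ hφ hφM ψ hψ
    refine tendsto_of_seq_tendsto fun s hs => ?_
    set u : ℕ → X → ℝ := fun k x => ∏ i, φ i (f^[∑ j ∈ Finset.Iic i, s k j] x) with hu
    have hum : ∀ k, Measurable (u k) := fun k =>
      Finset.measurable_prod _ fun i _ => (hφ i).continuous.measurable.comp (hfn _).measurable
    have huM : ∀ k x, |u k x| ≤ M ^ (N + 1) := fun k x => abs_prod_univ_le fun i => hφM i _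
    have htimes : ∀ i, Tendsto (fun k => ∑ j ∈ Finset.Iic i, s k j) atTop atTop := fun i => by
      have hsi : Tendsto (fun k => s k i) atTop atTop := (tendsto_atTop_fin_iff.1 hs) i
      exact tendsto_atTop_mono (fun k => Finset.single_le_sum (f := fun j => s k j)
        (fun _ _ => Nat.zero_le _) (Finset.mem_Iic.2 le_rfl)) hsi
    have hus : ∀ x, ∀ y ∈ Wss f x, Tendsto (fun k => u k x - u k y) atTop (𝓝 0) := by
      intro x y hy
      have h1 : Tendsto (fun k => M ^ (Finset.univ : Finset (Fin (N + 1))).card *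
          ∑ i, |φ i (f^[∑ j ∈ Finset.Iic i, s k j] x) - φ i (f^[∑ j ∈ Finset.Iic i, s k j] y)|)
          atTop (𝓝 0) := by
        have h2 := (tendsto_finsetSum Finset.univ fun (i : Fin (N + 1)) _ =>
          ((hφ i).tendsto_sub_of_mem_stableSet hy (htimes i)).abs).const_mul
          (M ^ (Finset.univ : Finset (Fin (N + 1))).card)
        simpa only [abs_zero, Finset.sum_const_zero, mul_zero] using h2
      exact squeeze_zero_norm (fun k => abs_prod_sub_prod_le _ hM (fun i _ => hφM i _)
        fun i _ => hφM i _) h1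
    have huint : ∀ k, Integrable (u k) μ := fun k =>
      Integrable.of_bound (hum k).aestronglyMeasurable _ (ae_of_all _ (huM k))
    have hmean : Tendsto (fun k => ∫ x, u k x ∂μ) atTop (𝓝 (∏ i, ∫ y, φ i y ∂μ)) := by
      have hφ0 : Integrable (φ 0) μ :=
        Integrable.of_bound (hφ 0).continuous.aestronglyMeasurable M (ae_of_all _ (hφM 0))
      have htail : Tendsto (fun k (i : Fin N) => s k i.succ) atTop atTop :=
        tendsto_atTop_fin_iff.2 fun i => (tendsto_atTop_fin_iff.1 hs) i.succ
      have h1 := (ih (fun i => φ i.succ) (fun i => hφ _) (fun i => hφM _) (φ 0) hφ0).comp htail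
      rw [integral_const_mul, mul_comm, ← Fin.prod_univ_succ (fun i => ∫ y, φ i y ∂μ)] at h1
      refine h1.congr fun k => ?_
      simp only [Function.comp_apply]
      have hmeas : Measurable fun x =>
          (∏ i : Fin N, φ i.succ (f^[∑ j ∈ Finset.Iic i, s k j.succ] x)) * φ 0 x :=
        (Finset.measurable_prod _ fun i _ =>
          (hφ _).continuous.measurable.comp (hfn _).measurable).mul (hφ 0).continuous.measurable
      rw [← (hfn (s k 0)).integral_comp_of_aestronglyMeasurable hmeas.aestronglyMeasurable]
      refine integral_congr_ae (ae_of_all _ fun x => ?_)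
      have h0 : Finset.Iic (0 : Fin (N + 1)) = {0} := by ext i; simp
      simp only [hu, Fin.prod_univ_succ, sum_Iic_succ, h0, Finset.sum_singleton,
        Function.iterate_add_apply]
      rw [mul_comm]
    have hψ' : Integrable (fun x => ψ x - ∫ y, ψ y ∂μ) μ := hψ.sub (integrable_const _)
    have hdec := tendsto_integral_mul_of_asymptotically_saturated hconst hum
      (pow_nonneg hM0 _) huM hus hψ' (by
        rw [integral_sub hψ (integrable_const _)]; simp)
    have hsum := hdec.add (hmean.mul_const (∫ y, ψ y ∂μ))
    rw [zero_add, ← integral_const_mul] at hsum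
    refine hsum.congr fun k => ?_
    rw [← integral_mul_const, ← integral_add
      (hψ'.bdd_mul (hum k).aestronglyMeasurable (ae_of_all _ (huM k))) ((huint k).mul_const _)]
    exact integral_congr_ae (ae_of_all _ fun x => by ring)

/-- Replacing each `φ i` by an `L¹`-close uniformly continuous function costs an error uniform in
`n`, as `f` preserves `μ` and all other factors are bounded. This is why `ψ` is bounded here. -/
theorem tendsto_integral_prod_of_bounded (hf : MeasurePreserving f μ μ)
    (hconst : ∀ g : X → ℝ, SaturatedAE f μ g → Measurable g → ∀ M, 0 ≤ M → (∀ x, |g x| ≤ M) →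
      ∃ c : ℝ, ∀ᵐ x ∂μ, g x = c) {M : ℝ} (hM : 1 ≤ M) {N : ℕ} {φ : Fin N → X → ℝ}
    (hφ : ∀ i, AEStronglyMeasurable (φ i) μ) (hφM : ∀ i, ∀ᵐ x ∂μ, |φ i x| ≤ M)
    {ψ : X → ℝ} (hψ : AEStronglyMeasurable ψ μ) {K : ℝ} (hψK : ∀ x, |ψ x| ≤ K) :
    Tendsto (fun n : Fin N → ℕ => ∫ x, (∏ i, φ i (f^[∑ j ∈ Finset.Iic i, n j] x)) * ψ x ∂μ)
      atTop (𝓝 (∫ x, (∏ i, ∫ y, φ i y ∂μ) * ψ x ∂μ)) := by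
  have hM0 : 0 ≤ M := zero_le_one.trans hM
  have hfn : ∀ n : ℕ, MeasurePreserving f^[n] μ μ := fun n => hf.iterate n
  obtain ⟨x₀⟩ : Nonempty X := nonempty_of_isProbabilityMeasure μ
  have hK0 : 0 ≤ K := (abs_nonneg _).trans (hψK x₀)
  have hψi : Integrable ψ μ := Integrable.of_bound hψ K (ae_of_all _ hψK)
  refine tendsto_of_forall_approx fun ε hε => ?_
  -- The total error is `M ^ N * N * K` times the precision `ε / A`; the added ones keep `A`
  -- positive when `N` or `K` vanishes.
  set A : ℝ := M ^ N * (N + 1) * (K + 1) with hA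
  have hApos : 0 < A := by positivity
  choose g hgu hgM hg using fun i => exists_uniformContinuous_abs_le_integral_sub_le (μ := μ)
    (hφ i) hM0 (hφM i) (div_pos hε hApos)
  have hgm : ∀ i, AEStronglyMeasurable (g i) μ := fun i => (hgu i).continuous.aestronglyMeasurable
  have hφi : ∀ i, Integrable (φ i) μ := fun i => Integrable.of_bound (hφ i) M (hφM i)
  have hgi : ∀ i, Integrable (g i) μ := fun i =>
    Integrable.of_bound (hgm i) M (ae_of_all _ (hgM i))
  have hdi : ∀ i, Integrable (fun x => |φ i x - g i x|) μ := fun i => ((hφi i).sub (hgi i)).abs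
  have hbound : M ^ N * ∑ _i : Fin N, ε / A ≤ ε / (K + 1) := by
    rw [Finset.sum_const, Finset.card_univ, Fintype.card_fin, nsmul_eq_mul, hA]
    rw [show M ^ N * ((N : ℝ) * (ε / (M ^ N * (N + 1) * (K + 1))))
      = (ε / (K + 1)) * (N / (N + 1)) by field_simp]
    refine mul_le_of_le_one_right (by positivity) ?_
    rw [div_le_one (by positivity)]
    linarith
  have hKε : ε / (K + 1) * K ≤ ε := by
    rw [div_mul_eq_mul_div, div_le_iff₀ (by positivity)]
    nlinarith
  refine ⟨_, _, tendsto_integral_prod_of_uniformContinuous hf hconst hM N g hgu hgM ψ hψi,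
    fun n => ?_, ?_⟩
  · have hφn : ∀ i, ∀ m : ℕ, AEStronglyMeasurable (fun x => φ i (f^[m] x)) μ := fun i m =>
      (hφ i).comp_measurePreserving (hfn m)
    have hφnM : ∀ᵐ x ∂μ, ∀ i, |φ i (f^[∑ j ∈ Finset.Iic i, n j] x)| ≤ M :=
      ae_all_iff.2 fun i => (hfn _).quasiMeasurePreserving.ae (hφM i)
    have h1 : Integrable (fun x => (∏ i, φ i (f^[∑ j ∈ Finset.Iic i, n j] x)) * ψ x) μ :=
      hψi.bdd_mul (c := M ^ N) (Finset.aestronglyMeasurable_fun_prod _ fun i _ => hφn i _) (by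
        filter_upwards [hφnM] with x hx
        exact abs_prod_univ_le hx)
    have h2 : Integrable (fun x => (∏ i, g i (f^[∑ j ∈ Finset.Iic i, n j] x)) * ψ x) μ :=
      hψi.bdd_mul (c := M ^ N) (Finset.aestronglyMeasurable_fun_prod _ fun i _ =>
        (hgm i).comp_measurePreserving (hfn _)) (ae_of_all _ fun x =>
          abs_prod_univ_le fun i => hgM i _)
    have hdn : ∀ i, Integrable (fun x => |φ i (f^[∑ j ∈ Finset.Iic i, n j] x)
        - g i (f^[∑ j ∈ Finset.Iic i, n j] x)|) μ := fun i =>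
      (hfn _).integrable_comp_of_integrable (hdi i)
    rw [← integral_sub h1 h2, ← Real.norm_eq_abs]
    refine (norm_integral_le_of_norm_le (((integrable_finsetSum Finset.univ
      fun i _ => hdn i).const_mul (M ^ N)).mul_const K) ?_).trans ?_
    · filter_upwards [hφnM] with x hx
      rw [← sub_mul, norm_mul]
      refine mul_le_mul ?_ (hψK x) (norm_nonneg _) (mul_nonneg (pow_nonneg hM0 _)
        (Finset.sum_nonneg fun _ _ => abs_nonneg _))
      simpa using abs_prod_sub_prod_le Finset.univ hM (fun i _ => hx i)
        (fun i _ => hgM i (f^[∑ j ∈ Finset.Iic i, n j] x))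
    · rw [integral_mul_const, integral_const_mul, integral_finsetSum _ fun i _ => hdn i]
      refine le_trans (mul_le_mul_of_nonneg_right ?_ hK0) hKε
      refine le_trans (mul_le_mul_of_nonneg_left (Finset.sum_le_sum fun i _ => ?_)
        (pow_nonneg hM0 _)) hbound
      exact ((hfn _).integral_comp_of_aestronglyMeasurable
        (hdi i).aestronglyMeasurable).trans_le (hg i)
  · have hprob : ∀ h : X → ℝ, (∀ᵐ x ∂μ, |h x| ≤ M) → |∫ x, h x ∂μ| ≤ M := fun h hh => by
      simpa using norm_integral_le_of_norm_le_const (f := h) hh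
    rw [integral_const_mul, integral_const_mul, ← sub_mul, abs_mul]
    have hψI : |∫ x, ψ x ∂μ| ≤ K := by
      simpa using norm_integral_le_of_norm_le_const (f := ψ) (ae_of_all μ hψK)
    refine (mul_le_mul ?_ hψI (abs_nonneg _) (by positivity)).trans hKε
    refine (abs_prod_sub_prod_le Finset.univ hM (fun i _ => hprob _ (hφM i))
      fun i _ => hprob _ (ae_of_all _ (hgM i))).trans ?_
    rw [Finset.card_univ, Fintype.card_fin]
    refine le_trans (mul_le_mul_of_nonneg_left (Finset.sum_le_sum fun i _ => ?_)
      (pow_nonneg hM0 _)) hbound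
    rw [← integral_sub (hφi i) (hgi i)]
    exact abs_integral_le_integral_abs.trans (hg i)

theorem multiplyMixing_of_forall_saturatedAE (hf : MeasurePreserving f μ μ)
    (hconst : ∀ g : X → ℝ, SaturatedAE f μ g → Measurable g → ∀ M, 0 ≤ M → (∀ x, |g x| ≤ M) →
      ∃ c : ℝ, ∀ᵐ x ∂μ, g x = c) : MultiplyMixing f μ := by
  intro N φ hφ ψ hψ
  have hfn : ∀ n : ℕ, MeasurePreserving f^[n] μ μ := fun n => hf.iterate n
  have hψi : Integrable ψ μ := hψ.integrable one_le_two
  set M : ℝ := 1 + ∑ i, (eLpNorm (φ i) ⊤ μ).toReal with hMdef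
  have hM : 1 ≤ M := le_add_of_nonneg_right (Finset.sum_nonneg fun _ _ => ENNReal.toReal_nonneg)
  have hM0 : 0 ≤ M := zero_le_one.trans hM
  have hφM : ∀ i, ∀ᵐ x ∂μ, |φ i x| ≤ M := fun i => by
    have h1 : (eLpNorm (φ i) ⊤ μ).toReal ≤ M :=
      (Finset.single_le_sum (f := fun i => (eLpNorm (φ i) ⊤ μ).toReal)
        (fun _ _ => ENNReal.toReal_nonneg) (Finset.mem_univ i)).trans
        (le_add_of_nonneg_left zero_le_one)
    have h2 := ae_le_eLpNormEssSup (f := φ i) (μ := μ)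
    filter_upwards [h2] with x hx
    rw [← eLpNorm_exponent_top] at hx
    refine le_trans ?_ h1
    rw [← Real.norm_eq_abs, ← toReal_enorm]
    exact ENNReal.toReal_mono (hφ i).2.ne hx
  refine tendsto_of_forall_approx fun ε hε => ?_
  -- The products are bounded by `M ^ N`, so an `L¹`-approximation of `ψ` by a bounded function
  -- suffices.
  obtain ⟨ψ', hψ', hψ'i⟩ := hψi.exists_boundedContinuous_integral_sub_le
    (div_pos hε (pow_pos (zero_lt_one.trans_le hM) N))
  have hle : ∫ x, M ^ N * ‖ψ x - ψ' x‖ ∂μ ≤ ε := by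
    rw [integral_const_mul]
    refine (mul_le_mul_of_nonneg_left hψ' (pow_nonneg hM0 N)).trans_eq ?_
    rw [mul_div_cancel₀ _ (pow_pos (zero_lt_one.trans_le hM) N).ne']
  have hmain : ∀ a : X → ℝ, AEStronglyMeasurable a μ → (∀ᵐ x ∂μ, |a x| ≤ M ^ N) →
      |∫ x, a x * ψ x ∂μ - ∫ x, a x * ψ' x ∂μ| ≤ ε := by
    intro a ha haM
    rw [← integral_sub (hψi.bdd_mul ha haM) (hψ'i.bdd_mul ha haM), ← Real.norm_eq_abs]
    refine (norm_integral_le_of_norm_le ((hψi.sub hψ'i).norm.const_mul (M ^ N)) ?_).trans hle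
    filter_upwards [haM] with x hx
    rw [← mul_sub, norm_mul]
    exact mul_le_mul_of_nonneg_right hx (norm_nonneg _)
  refine ⟨_, _, tendsto_integral_prod_of_bounded hf hconst hM (fun i => (hφ i).1) hφM
    (ψ := ψ') ψ'.continuous.aestronglyMeasurable (K := ‖ψ'‖) (fun x => ψ'.norm_coe_le_norm x),
    fun n => hmain _ ?_ ?_, hmain _ aestronglyMeasurable_const (ae_of_all _ fun _ => ?_)⟩
  · exact Finset.aestronglyMeasurable_fun_prod _ fun i _ =>
      (hφ i).1.comp_measurePreserving (hfn _)
  · filter_upwards [ae_all_iff.2 fun i => (hfn (∑ j ∈ Finset.Iic i, n j)).quasiMeasurePreserving.ae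
      (hφM i)] with x hx
    exact abs_prod_univ_le hx
  · exact abs_prod_univ_le fun i => by simpa using norm_integral_le_of_norm_le_const (f := φ i) (hφM i)

end

/-! ### Total ergodicity and the conclusion -/

/-- For an `f^n`-invariant set `s`, mixing of one factor along the times `n * k`, with `φ = ψ` the
indicator of `s`, gives `μ(s) = μ(s)²`. The times tend to infinity because `n ≥ 1`. -/
theorem MultiplyMixing.totallyErgodic {X : Type*} [MeasurableSpace X] {f : X → X} {μ : Measure X}
    [IsProbabilityMeasure μ] (hf : MeasurePreserving f μ μ) (h : MultiplyMixing f μ) :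
    TotallyErgodic f μ := by
  intro n hn
  refine ⟨hf.iterate n, ⟨fun s hs hinv => ?_⟩⟩
  have hmem : ∀ p : ENNReal, MemLp (s.indicator fun _ => (1 : ℝ)) p μ := fun p =>
    (memLp_const 1).indicator hs
  have hlim := h 1 (fun _ => s.indicator fun _ => 1) (fun _ => hmem _)
    (s.indicator fun _ => 1) (hmem 2)
  have htimes : Tendsto (fun k : ℕ => (fun _ : Fin 1 => n * k)) atTop atTop :=
    tendsto_atTop_fin_iff.2 fun _ => tendsto_id.const_mul_atTop' hn
  have hiter : ∀ k x, s.indicator (fun _ => (1 : ℝ)) (f^[n * k] x) = s.indicator (fun _ => 1) x := by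
    intro k x
    have hk : ∀ k : ℕ, ((f^[n])^[k]) ⁻¹' s = s := fun k => by
      rw [Set.preimage_iterate_eq]
      exact Function.iterate_fixed hinv k
    have : f^[n * k] x ∈ s ↔ x ∈ s := by
      rw [Function.iterate_mul]
      exact Set.ext_iff.1 (hk k) x
    by_cases hx : x ∈ s <;> simp [hx, this]
  have h0 : ∀ i : Fin 1, Finset.Iic i = {i} := fun i => by
    ext j; simp [Subsingleton.elim j i]
  have hlim' := hlim.comp htimes
  simp only [Function.comp_def, h0, Finset.sum_singleton, Finset.univ_unique, Finset.prod_singleton,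
    hiter, integral_const_mul] at hlim'
  have heq := tendsto_nhds_unique tendsto_const_nhds hlim'
  have hsq : ∀ x, s.indicator (fun _ => (1 : ℝ)) x * s.indicator (fun _ => 1) x
      = s.indicator (fun _ => 1) x := fun x => by by_cases hx : x ∈ s <;> simp [hx]
  simp only [hsq, integral_indicator_const _ hs, smul_eq_mul, mul_one] at heq
  rw [eventuallyConst_set']
  rcases mul_eq_zero.1 (show μ.real s * (μ.real s - 1) = 0 by linarith) with h1 | h1
  · exact .inl (ae_eq_empty.2 ((measureReal_eq_zero_iff).1 h1))
  · refine .inr (eventuallyEq_univ.2 ?_)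
    rw [mem_ae_iff, prob_compl_eq_zero_iff hs]
    have h2 : (μ s).toReal = 1 := sub_eq_zero.1 h1
    exact (ENNReal.toReal_eq_one_iff _).1 h2

theorem mainTheorem7 {X : Type*} [MetricSpace X] [TopologicalSpace.SeparableSpace X]
    [MeasurableSpace X] [BorelSpace X]
    (μ : Measure X) [IsProbabilityMeasure μ] (hconn : IsConnected μ.support)
    (f : X ≃ᵐ X) (hf : MeasurePreserving f μ μ)
    (hcover : ∀ x ∈ μ.support, ∃ V : Set X, IsOpen V ∧ x ∈ V ∧
      ∃ P : ProductStructure (Wss f) (Wsu f) V, P.IsAbsolutelyContinuous μ) :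
    TotallyErgodic f μ ∧ MultiplyMixing f μ := by
  have h : MultiplyMixing f μ := multiplyMixing_of_forall_saturatedAE hf
    fun _ hg hgm _ hM hgM => hg.exists_ae_eq_const hconn hf hcover hgm hM hgM
  exact ⟨h.totallyErgodic hf, h⟩
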